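/- **Model.** Let $d\ge 1$, $\alpha>d$, $m\in\mathbb N_+$, $\beta>0$. All channel power gains are independent with the unit-mean Nakagami-$m$ power law, i.e. the Gamma law with shape $m$ and mean $1$. For $\lambda\ge 0$ let $\{(X_i,\tilde H_i)\}$ be a homogeneous Poisson point process of intensity $\lambda$ on $\mathbb R^d$ independently marked with channel gains, and let $I=\sum_{i:\,|X_i|\ge 1}\tilde H_i|X_i|^{-\alpha}$ be the aggregate interference. The cluster of the typical transmitter, located at the origin, is the ball $B(0,s)$, $s\ge 1$, of volume $\mu_r$; its intended receivers form a Poisson point process of intensity $\lambda_r>0$ in $B(0,s)$, and $k=\mu_r\lambda_r$ is their mean number. A receiver at $y$ is connected within $\tau\in\mathbb N_+$ attempts if $H_i\ge\beta|y|^\alpha I_i$ for some $i\in\{1,\dots,\tau\}$, where $H_1,\dots,H_\tau$ are channel gains and $I_1,\dots,I_\tau$ are copies of $I$, all independent, also between receivers (correlations of the interference in time and space are neglected). The multicast outage probability is the probability that some intended receiver is not connected within $\tau$ attempts; equivalently it is $1-\exp\{-\int_{B(0,s)}(\lambda_r-\lambda_c(y,\tau))\,dy\}$, with $\lambda_c(y,\tau)=\lambda_r\,\mathbb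 P[\max_{i\le\tau}(H_i-\beta|y|^\alpha I_i)\ge 0]$. Let $\bar\lambda_\epsilon$ be the maximal $\lambda$ for which the outage probability is at most $\epsilon$; let $$b=\mathbb E\Big[\log\Big(1+\frac{\max_{i\le\tau}H_i\; s^{-\alpha}}{I}\Big)\Big]$$ be the ergodic multicast rate at the cluster edge for $\lambda=\bar\lambda_\epsilon$ (with $H_1,\dots,H_\tau,I$ independent), let $$C_\epsilon=\frac1\tau\,b\,\bar\lambda_\epsilon\,(1-\epsilon)$$ be the multicast transmission capacity, and let $\rho=\frac1{\tau^2}(\epsilon(\tau+1))^{1/\tau}$. **Statement.** Fix $\epsilon_0\in(0,1)$. Below, $g=\Theta(f)$ means that there are constants $0<c\le C$, not depending on $\tau$ or $\epsilon$, such that for all $\tau\in\mathbb N_+$ and $\epsilon\in(0,\epsilon_0]$ there is $k_0$ with $c f\le g\le C f$ whenever $k\ge k_0$. (0) In every network, i.e. for all $s\ge1$ and $\lambda_r>0$, if $k\ge k_0(\tau,\epsilon)$ then the maximum $\bar\lambda_\epsilon$ exists, the expectation $b$ is finite, and $b=\Theta(\log(k)/\tau)$, with $c,C$ depending only on $d,\alpha,m,\beta,\epsilon_0$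 and $k_0$ only on these, $\tau$ and $\epsilon$. Moreover $C_\epsilon=\Theta(\rho\,k^{x}\log k)$, with (i) dense networks ($s\ge 1$ fixed, $\lambda_r$ varies): $x=-\frac1\tau$; (ii) large networks ($\lambda_r>0$ fixed, $s\ge1$ varies): $x=-\left(1+\frac1\tau\right)$; (iii) large dense networks ($s\ge 1$ and $\lambda_r$ vary with $a\mu_r\le\lambda_r\le A\mu_r$ for fixed $0<a\le A$): $x=-\frac{\tau+2}{2\tau}$. Here $c,C$ depend only on $d,\alpha,m,\beta,\epsilon_0$ and on the fixed quantity ($s$; $\lambda_r$; $a,A$, respectively), and $k_0$ depends on these and on $\tau,\epsilon$. -/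

import Mathlib

open MeasureTheory ProbabilityTheory
open scoped ENNReal Nat

noncomputable section

namespace Multicast

/-! ### Poisson point processes -/

/-- The law of the Poisson point process with finite intensity measure `Λ`, as a law on
configurations (a configuration is the counting measure of its points): there are exactly `n` points
with probability `e ^ (-Λ(X)) Λ(X) ^ n / n!`, and these are then i.i.d. with law `Λ / Λ(X)`. -/
def finitePoisson {X : Type*} [MeasurableSpace X] (Λ : Measure X) : Measure (Measure X) :=
  ENNReal.ofReal (Real.exp (-(Λ Set.univ).toReal)) •
    Measure.sum fun n : ℕ => ((n ! : ℕ) : ℝ≥0∞)⁻¹ •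
      (Measure.pi fun _ : Fin n => Λ).map fun x => ∑ i, Measure.dirac (x i)

/-- The law of the Poisson point process with (s-finite) intensity measure `Λ`: the superposition of
independent Poisson point processes with finite intensity measures that sum to `Λ`. -/
def poissonProcess {X : Type*} [MeasurableSpace X] (Λ : Measure X) [SFinite Λ] :
    Measure (Measure X) :=
  (Measure.infinitePi fun n => finitePoisson (sfiniteSeq Λ n)).map fun N => Measure.sum N

lemma measurable_sum_dirac {X : Type*} [MeasurableSpace X] (n : ℕ) :
    Measurable fun x : Fin n → X => ∑ i, Measure.dirac (x i) := by
  refine Measure.measurable_of_measurable_coe _ fun s hs => ?_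
  simp only [Measure.coe_finsetSum, Finset.sum_apply]
  exact Finset.measurable_sum _ fun i _ =>
    (Measure.measurable_coe hs).comp (Measure.measurable_dirac.comp (measurable_pi_apply i))

lemma measurable_measure_sum {X : Type*} [MeasurableSpace X] :
    Measurable fun N : ℕ → Measure X => Measure.sum N := by
  refine Measure.measurable_of_measurable_coe _ fun s hs => ?_
  simp only [Measure.sum_apply _ hs]
  exact Measurable.tsum fun i => (Measure.measurable_coe hs).comp (measurable_pi_apply i)

instance isProbabilityMeasure_finitePoisson {X : Type*} [MeasurableSpace X] (Λ : Measure X)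
    [IsFiniteMeasure Λ] : IsProbabilityMeasure (finitePoisson Λ) := by
  refine ⟨?_⟩
  have h1 : ∀ n : ℕ, (((n ! : ℕ) : ℝ≥0∞)⁻¹ • (Measure.pi fun _ : Fin n => Λ).map
      fun x => ∑ i, Measure.dirac (x i)) Set.univ
      = ENNReal.ofReal ((Λ Set.univ).toReal ^ n / (n ! : ℕ)) := by
    intro n
    rw [Measure.smul_apply, Measure.map_apply (measurable_sum_dirac n) MeasurableSet.univ,
      Set.preimage_univ, Measure.pi_univ, Finset.prod_const, Finset.card_univ, Fintype.card_fin,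
      smul_eq_mul, ENNReal.ofReal_div_of_pos (by positivity), ENNReal.ofReal_pow (by positivity),
      ENNReal.ofReal_toReal (measure_ne_top _ _), ENNReal.ofReal_natCast, ENNReal.div_eq_inv_mul]
  have h2 := Real.summable_pow_div_factorial (Λ Set.univ).toReal
  have h3 : ∑' n : ℕ, (Λ Set.univ).toReal ^ n / ((n ! : ℕ) : ℝ)
      = Real.exp (Λ Set.univ).toReal := by
    rw [Real.exp_eq_exp_ℝ, NormedSpace.exp_eq_tsum_div]
  rw [finitePoisson, Measure.smul_apply, Measure.sum_apply _ MeasurableSet.univ, smul_eq_mul]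
  simp only [h1]
  rw [← ENNReal.ofReal_tsum_of_nonneg (fun n => by positivity) h2, h3,
    ← ENNReal.ofReal_mul (by positivity), ← Real.exp_add]
  simp

instance isProbabilityMeasure_poissonProcess {X : Type*} [MeasurableSpace X] (Λ : Measure X)
    [SFinite Λ] : IsProbabilityMeasure (poissonProcess Λ) :=
  Measure.isProbabilityMeasure_map measurable_measure_sum.aemeasurable

/-! ### Fading and interference -/

/-- The law of a channel power gain under Nakagami-`m` fading with unit mean. -/
def fadingLaw (m : ℕ) : Measure ℝ := gammaMeasure m m

instance sigmaFinite_fadingLaw (m : ℕ) : SigmaFinite (fadingLaw m) :=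
  SigmaFinite.withDensity_ofReal _

/-- The truncated path loss `‖x‖ ^ (-α)` of an interferer, equal to `0` for `‖x‖ < 1`. -/
def pathLoss {d : ℕ} (α : ℝ) (x : EuclideanSpace ℝ (Fin d)) : ℝ :=
  if 1 ≤ ‖x‖ then ‖x‖ ^ (-α) else 0

/-- The aggregate interference at the origin, `∑ H_i ‖X_i‖ ^ (-α)`, the sum being over the points
`(X_i, H_i)` (position and channel gain of an interferer) of the configuration `N`. -/
def interference {d : ℕ} (α : ℝ) (N : Measure (EuclideanSpace ℝ (Fin d) × ℝ)) : ℝ :=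
  (∫⁻ p, ENNReal.ofReal (p.2 * pathLoss α p.1) ∂N).toReal

/-- The law of the aggregate interference when the transmitters form a homogeneous Poisson point
process of intensity `lam` on `ℝ ^ d`, independently marked with their channel gains. -/
def interferenceLaw (d : ℕ) (α : ℝ) (m : ℕ) (lam : ℝ) : Measure ℝ :=
  (poissonProcess ((ENNReal.ofReal lam • (volume : Measure (EuclideanSpace ℝ (Fin d)))).prod
    (fadingLaw m))).map (interference α)

lemma measurable_interference {d : ℕ} (α : ℝ) : Measurable (interference (d := d) α) := by
  refine (Measure.measurable_lintegral ?_).ennreal_toReal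
  have : Measurable (pathLoss (d := d) α) := by
    unfold pathLoss
    exact Measurable.ite (measurableSet_le measurable_const measurable_norm)
      (measurable_norm.pow_const _) measurable_const
  exact (measurable_snd.mul (this.comp measurable_fst)).ennreal_ofReal

instance isProbabilityMeasure_interferenceLaw (d : ℕ) (α : ℝ) (m : ℕ) (lam : ℝ) :
    IsProbabilityMeasure (interferenceLaw d α m lam) :=
  Measure.isProbabilityMeasure_map (measurable_interference α).aemeasurable

/-! ### Clusters, outage, multicast rate and capacity -/

/-- The cluster of the typical transmitter, which sits at the origin: the ball of radius `s`. -/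
def cluster (d : ℕ) (s : ℝ) : Set (EuclideanSpace ℝ (Fin d)) := Metric.closedBall 0 s

/-- The volume `μ_r` of a cluster. -/
def clusterVolume (d : ℕ) (s : ℝ) : ℝ := (volume (cluster d s)).toReal

/-- The mean number `k = μ_r λ_r` of intended receivers in a cluster. -/
def meanReceivers (d : ℕ) (s lamR : ℝ) : ℝ := clusterVolume d s * lamR

/-- The intensity measure of the intended receivers of the typical transmitter. Each receiver at
`y` is marked, for each of the `τ` attempts `i`, with the pair `(H_i, I_i)` of its channel gain and
the interference it sees in that attempt; all these marks are independent. -/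
def receiverIntensity (d : ℕ) (α : ℝ) (m τ : ℕ) (s lamR lam : ℝ) :
    Measure (EuclideanSpace ℝ (Fin d) × (Fin τ → ℝ × ℝ)) :=
  (ENNReal.ofReal lamR • (volume.restrict (cluster d s))).prod
    (Measure.pi fun _ : Fin τ => (fadingLaw m).prod (interferenceLaw d α m lam))

instance sFinite_receiverIntensity (d : ℕ) (α : ℝ) (m τ : ℕ) (s lamR lam : ℝ) :
    SFinite (receiverIntensity d α m τ s lamR lam) := by
  unfold receiverIntensity; infer_instance

/-- A receiver is connected if in some attempt its signal-to-interference ratio reaches `β`, that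
is, `H_i ≥ β |y| ^ α I_i`. -/
def Connected {d : ℕ} (α β : ℝ) {τ : ℕ}
    (p : EuclideanSpace ℝ (Fin d) × (Fin τ → ℝ × ℝ)) : Prop :=
  ∃ i, β * ‖p.1‖ ^ α * (p.2 i).2 ≤ (p.2 i).1

/-- The multicast outage probability: the probability that some intended receiver is not connected
within `τ` attempts. -/
def outage (d : ℕ) (α : ℝ) (m : ℕ) (β : ℝ) (τ : ℕ) (s lamR lam : ℝ) : ℝ :=
  (poissonProcess (receiverIntensity d α m τ s lamR lam)).real
    {N | N {p | ¬ Connected α β p} ≠ 0}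

/-- The contention intensities for which the outage probability is at most `ε`. -/
def feasible (d : ℕ) (α : ℝ) (m : ℕ) (β : ℝ) (τ : ℕ) (s lamR ε : ℝ) : Set ℝ :=
  {lam | 0 ≤ lam ∧ outage d α m β τ s lamR lam ≤ ε}

/-- The maximum contention intensity. -/
def maxIntensity (d : ℕ) (α : ℝ) (m : ℕ) (β : ℝ) (τ : ℕ) (s lamR ε : ℝ) : ℝ :=
  sSup (feasible d α m β τ s lamR ε)

/-- `log (1 + H_max s ^ (-α) / I)`, as a function of the gains `H_i` and the interference `I`. -/
def edgeRate (α : ℝ) {τ : ℕ} (s : ℝ) (p : (Fin τ → ℝ) × ℝ) : ℝ :=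
  Real.log (1 + (⨆ i, p.1 i) * s ^ (-α) / p.2)

/-- The joint law of the i.i.d. gains `H_1, …, H_τ` and of the interference, independent of them. -/
def edgeLaw (d : ℕ) (α : ℝ) (m τ : ℕ) (lam : ℝ) : Measure ((Fin τ → ℝ) × ℝ) :=
  (Measure.pi fun _ : Fin τ => fadingLaw m).prod (interferenceLaw d α m lam)

/-- The ergodic multicast rate at the cluster edge, for contention intensity `lam`. -/
def multicastRate (d : ℕ) (α : ℝ) (m τ : ℕ) (s lam : ℝ) : ℝ :=
  ∫ p, edgeRate α s p ∂(edgeLaw d α m τ lam)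

/-- The multicast transmission capacity `C_ε = (1 / τ) b lam_ε (1 - ε)`, the rate `b` being taken at
the maximum contention intensity `lam_ε`. -/
def capacity (d : ℕ) (α : ℝ) (m : ℕ) (β : ℝ) (τ : ℕ) (s lamR ε : ℝ) : ℝ :=
  1 / τ * multicastRate d α m τ s (maxIntensity d α m β τ s lamR ε) *
    maxIntensity d α m β τ s lamR ε * (1 - ε)

/-- `ρ = (1 / τ ^ 2) (ε (τ + 1)) ^ (1 / τ)`. -/
def rho (τ : ℕ) (ε : ℝ) : ℝ := 1 / (τ : ℝ) ^ 2 * (ε * (τ + 1)) ^ (1 / (τ : ℝ))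

/-- `c f ≤ g ≤ C f` -/
def Between (c C f g : ℝ) : Prop := c * f ≤ g ∧ g ≤ C * f

end Multicast

end

noncomputable section

namespace Multicast

open Filter Topology Set

/-! ### The exponential `e ^ (-x)` on extended nonnegative reals -/

/-! Everything is governed by the dimensionless load `δ = λ s^d`. Unconnected receivers are a
thinning of a Poisson process, so the void probability gives outage `1 - e^{-Λ}`, where `Λ = λ_r ∫
p(y)^τ dy` over the cluster and `p(y)` is the failure probability of one attempt (`outage_eq`).

By scaling, the interference has typical size `λ^{α/d}`, and an attempt at distance `|y|` fails with
probability of order `λ |y|^d` as long as this is small. The upper bound (`failProb_le`) dominates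
the gamma density by an exponential one, so that the failure probability becomes a Laplace transform
of the interference, with exponent at most `K λ t^{d/α}` (`laplaceExponent_le`). The lower bound
(`le_failProb`) uses one strong, close interferer (`interferenceLaw_Iio_le`). Hence `Λ` is `k δ^τ`
up to constants raised to the power `τ` and a fixed factor. Solving `Λ = -log (1 - ε)` gives `δ ≍
(ε/k)^{1/τ}`; the `τ`-th root makes the constants uniform in `τ` (`maxIntensity_bounds`). The
maximum is attained because the outage is continuous in `λ` (`continuous_outage`).

For the rate, `s^{-α}/I = δ^{-α/d} (λ^{α/d}/I)`, and `λ^{α/d}/I` has bounded mean while `I` is of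
order `λ^{α/d}` with probability at least one half. So `b` is about `(α/d) log (1/δ)`, which is of
order `log k / τ` for large `k` (`multicastRate_le`, `le_multicastRate`, `network_bounds`). Since
`(τ+1)^{1/τ}` lies in `[1, 2]`, this gives `C_ε s^d ≍ ρ k^{-1/τ} log k` in every network
(`capacity_bounds`). The three regimes differ only in `s^{-d}`, which is constant, of order
`k^{-1}`, or of order `k^{-1/2}`. -/

/-- The function `x ↦ e ^ (-x)` on `[0, ∞]`, with value `0` at `∞`. -/
def negExp (x : ℝ≥0∞) : ℝ≥0∞ := EReal.exp (-(x : EReal))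

lemma continuous_negExp : Continuous negExp :=
  ENNReal.continuous_exp.comp (continuous_neg.comp continuous_coe_ennreal_ereal)

lemma measurable_negExp : Measurable negExp := continuous_negExp.measurable

@[simp] lemma negExp_zero : negExp 0 = 1 := by simp [negExp]

@[simp] lemma negExp_top : negExp ∞ = 0 := by simp [negExp]

lemma negExp_ofReal {x : ℝ} (hx : 0 ≤ x) :
    negExp (ENNReal.ofReal x) = ENNReal.ofReal (Real.exp (-x)) := by
  rw [negExp, EReal.coe_ennreal_ofReal, max_eq_left hx, ← EReal.coe_neg, EReal.exp_coe]

lemma negExp_of_ne_top {x : ℝ≥0∞} (hx : x ≠ ∞) :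
    negExp x = ENNReal.ofReal (Real.exp (-x.toReal)) := by
  rw [← negExp_ofReal ENNReal.toReal_nonneg, ENNReal.ofReal_toReal hx]

lemma negExp_add (x y : ℝ≥0∞) : negExp (x + y) = negExp x * negExp y := by
  by_cases hx : x = ∞
  · simp [hx]
  by_cases hy : y = ∞
  · simp [hy]
  rw [negExp_of_ne_top hx, negExp_of_ne_top hy, negExp_of_ne_top (by simp [hx, hy]),
    ENNReal.toReal_add hx hy, neg_add, Real.exp_add, ENNReal.ofReal_mul (Real.exp_pos _).le]

lemma negExp_le_one (x : ℝ≥0∞) : negExp x ≤ 1 := by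
  by_cases hx : x = ∞
  · simp [hx]
  rw [negExp_of_ne_top hx, ENNReal.ofReal_le_one, Real.exp_le_one_iff]
  simp

lemma one_sub_negExp_le (x : ℝ≥0∞) : 1 - negExp x ≤ x := by
  by_cases hx : x = ∞
  · simp [hx]
  rw [negExp_of_ne_top hx, ← ENNReal.ofReal_one, ← ENNReal.ofReal_sub _ (Real.exp_pos _).le]
  refine ENNReal.ofReal_le_of_le_toReal ?_
  linarith [Real.add_one_le_exp (-x.toReal)]

lemma negExp_sum {ι : Type*} (s : Finset ι) (f : ι → ℝ≥0∞) :
    negExp (∑ i ∈ s, f i) = ∏ i ∈ s, negExp (f i) := by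
  induction s using Finset.cons_induction with
  | empty => simp
  | cons a s ha ih => rw [Finset.sum_cons, negExp_add, ih, Finset.prod_cons]

lemma tendsto_prod_negExp (f : ℕ → ℝ≥0∞) :
    Tendsto (fun n => ∏ i ∈ Finset.range n, negExp (f i)) atTop (𝓝 (negExp (∑' i, f i))) := by
  simp_rw [← negExp_sum]
  exact (continuous_negExp.tendsto _).comp (ENNReal.tendsto_nat_tsum f)

/-! ### Laplace functional of a Poisson point process -/

lemma lintegral_pi_prod {X : Type*} [MeasurableSpace X] (Λ : Measure X) [SigmaFinite Λ]
    {g : X → ℝ≥0∞} (hg : Measurable g) (n : ℕ) :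
    ∫⁻ x, ∏ i, g (x i) ∂(Measure.pi fun _ : Fin n => Λ) = (∫⁻ x, g x ∂Λ) ^ n := by
  induction n with
  | zero => simp
  | succ n ih =>
    have hmp := (measurePreserving_piFinSuccAbove (fun _ : Fin (n + 1) => Λ) 0).symm
    rw [← hmp.lintegral_comp (by fun_prop)]
    simp_rw [MeasurableEquiv.piFinSuccAbove_symm_apply, Fin.insertNthEquiv,
      Fin.prod_univ_succ, Fin.insertNth_zero]
    simp only [Equiv.coe_fn_mk, Fin.cons_zero, Fin.cons_succ, cast_eq]
    rw [lintegral_prod_mul (f := g) (g := fun x : Fin n → X => ∏ i, g (x i)) hg.aemeasurable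
      (Measurable.aemeasurable (by fun_prop)), ih, pow_succ']

/-- Given `n` points the functional factorises into `(∫ e^{-f} dΛ)^n`. Summing over `n` with weights
`1/n!` gives an exponential series, and the normalisation `e^{-Λ(X)}` completes the exponent to `-∫
(1 - e^{-f}) dΛ`. -/
lemma lintegral_negExp_finitePoisson {X : Type*} [MeasurableSpace X] (Λ : Measure X)
    [IsFiniteMeasure Λ] {f : X → ℝ≥0∞} (hf : Measurable f) :
    ∫⁻ N, negExp (∫⁻ x, f x ∂N) ∂(finitePoisson Λ) = negExp (∫⁻ x, (1 - negExp (f x)) ∂Λ) := by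
  have hmeas : Measurable fun N : Measure X => negExp (∫⁻ x, f x ∂N) :=
    measurable_negExp.comp (Measure.measurable_lintegral hf)
  have hg : Measurable fun x => negExp (f x) := measurable_negExp.comp hf
  have hle : ∫⁻ x, negExp (f x) ∂Λ ≤ Λ univ := by
    calc ∫⁻ x, negExp (f x) ∂Λ ≤ ∫⁻ _, 1 ∂Λ := lintegral_mono fun x => negExp_le_one _
      _ = Λ univ := by simp
  have hfin : ∫⁻ x, negExp (f x) ∂Λ ≠ ∞ := (hle.trans_lt (measure_lt_top _ _)).ne
  have h1 : ∀ n : ℕ, ∫⁻ N, negExp (∫⁻ x, f x ∂N) ∂(((n ! : ℕ) : ℝ≥0∞)⁻¹ •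
      (Measure.pi fun _ : Fin n => Λ).map fun x => ∑ i, Measure.dirac (x i))
      = ENNReal.ofReal ((∫⁻ x, negExp (f x) ∂Λ).toReal ^ n / (n ! : ℕ)) := by
    intro n
    rw [lintegral_smul_measure, lintegral_map hmeas (measurable_sum_dirac n)]
    simp_rw [lintegral_finsetSum_measure, lintegral_dirac' _ hf, negExp_sum]
    rw [lintegral_pi_prod Λ hg, smul_eq_mul, ENNReal.ofReal_div_of_pos (by positivity),
      ENNReal.ofReal_pow (by positivity), ENNReal.ofReal_toReal hfin, ENNReal.ofReal_natCast,
      ENNReal.div_eq_inv_mul]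
  have h2 := Real.summable_pow_div_factorial (∫⁻ x, negExp (f x) ∂Λ).toReal
  have h3 : ∑' n : ℕ, (∫⁻ x, negExp (f x) ∂Λ).toReal ^ n / ((n ! : ℕ) : ℝ)
      = Real.exp (∫⁻ x, negExp (f x) ∂Λ).toReal := by
    rw [Real.exp_eq_exp_ℝ, NormedSpace.exp_eq_tsum_div]
  rw [finitePoisson, lintegral_smul_measure, lintegral_sum_measure, smul_eq_mul]
  simp only [h1]
  rw [← ENNReal.ofReal_tsum_of_nonneg (fun n => by positivity) h2, h3,
    ← ENNReal.ofReal_mul (by positivity), ← Real.exp_add,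
    lintegral_sub hg hfin (ae_of_all _ fun x => negExp_le_one _), lintegral_one,
    negExp_of_ne_top (ENNReal.sub_ne_top (measure_ne_top _ _)),
    ENNReal.toReal_sub_of_le hle (measure_ne_top _ _)]
  congr 2
  ring

/-- Independence of the finite pieces reduces partial products to the finite case. Since `negExp` is
continuous on all of `[0, ∞]` and at most `1`, dominated convergence passes to the full sum even
where it is infinite. -/
theorem lintegral_negExp_poissonProcess {X : Type*} [MeasurableSpace X] (Λ : Measure X)
    [SFinite Λ] {f : X → ℝ≥0∞} (hf : Measurable f) :
    ∫⁻ N, negExp (∫⁻ x, f x ∂N) ∂(poissonProcess Λ) = negExp (∫⁻ x, (1 - negExp (f x)) ∂Λ) := by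
  have hmeas : Measurable fun N : Measure X => negExp (∫⁻ x, f x ∂N) :=
    measurable_negExp.comp (Measure.measurable_lintegral hf)
  rw [poissonProcess, lintegral_map hmeas measurable_measure_sum]
  simp_rw [lintegral_sum_measure]
  have hlim : Tendsto (fun n => ∫⁻ N : ℕ → Measure X,
      ∏ i ∈ Finset.range n, negExp (∫⁻ x, f x ∂(N i))
        ∂(Measure.infinitePi fun n => finitePoisson (sfiniteSeq Λ n))) atTop
      (𝓝 (∫⁻ N : ℕ → Measure X, negExp (∑' i, ∫⁻ x, f x ∂(N i))
        ∂(Measure.infinitePi fun n => finitePoisson (sfiniteSeq Λ n)))) := by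
    refine tendsto_lintegral_of_dominated_convergence (fun _ => 1) (fun n => ?_) (fun n => ?_)
      (by simp) (ae_of_all _ fun N => tendsto_prod_negExp _)
    · exact Finset.measurable_prod _ fun i _ => hmeas.comp (measurable_pi_apply i)
    · exact ae_of_all _ fun N => Finset.prod_le_one' fun i _ => negExp_le_one _
  have hprod : ∀ n, ∫⁻ N : ℕ → Measure X,
      ∏ i ∈ Finset.range n, negExp (∫⁻ x, f x ∂(N i))
        ∂(Measure.infinitePi fun n => finitePoisson (sfiniteSeq Λ n))
      = ∏ i ∈ Finset.range n, negExp (∫⁻ x, (1 - negExp (f x)) ∂(sfiniteSeq Λ i)) := by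
    intro n
    have hind := iIndepFun_infinitePi (P := fun n => finitePoisson (sfiniteSeq Λ n))
      (X := fun (_ : ℕ) (N : Measure X) => negExp (∫⁻ x, f x ∂N)) (fun _ => hmeas)
    rw [lintegral_prod_eq_prod_lintegral_of_indepFun _ _ hind
      (fun i => hmeas.comp (measurable_pi_apply i))]
    refine Finset.prod_congr rfl fun i _ => ?_
    rw [(measurePreserving_eval_infinitePi (fun n => finitePoisson (sfiniteSeq Λ n))
      i).lintegral_comp hmeas, lintegral_negExp_finitePoisson _ hf]
  simp_rw [hprod] at hlim
  rw [tendsto_nhds_unique hlim (tendsto_prod_negExp _), ← lintegral_sum_measure, sum_sfiniteSeq]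

/-- The void probabilities of a Poisson point process. -/
theorem poissonProcess_void {X : Type*} [MeasurableSpace X] (Λ : Measure X) [SFinite Λ]
    {S : Set X} (hS : MeasurableSet S) :
    poissonProcess Λ {N | N S = 0} = negExp (Λ S) := by
  -- With `f = ∞` on `S`, the integrand is the indicator of having no point in `S`; this is why
  -- `negExp` is defined at `∞`.
  have h := lintegral_negExp_poissonProcess Λ (f := S.indicator fun _ => ∞)
    (measurable_const.indicator hS)
  have h1 : ∀ x, 1 - negExp (S.indicator (fun _ => ∞) x) = S.indicator (fun _ => 1) x := by
    intro x
    by_cases hx : x ∈ S <;> simp [hx]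
  have h2 : ∀ N : Measure X, negExp (∫⁻ x, S.indicator (fun _ => ∞) x ∂N)
      = {N : Measure X | N S = 0}.indicator (fun _ => 1) N := by
    intro N
    rw [lintegral_indicator_const hS]
    by_cases hN : N S = 0
    · simp [hN]
    · simp [hN, ENNReal.top_mul hN]
  simp_rw [h1, h2] at h
  have hm : MeasurableSet {N : Measure X | N S = 0} :=
    Measure.measurable_coe hS (measurableSet_singleton 0)
  rwa [lintegral_indicator_const hm, lintegral_indicator_const hS, one_mul, one_mul] at h

/-- Configurations are arbitrary measures by type, and only almost surely sums of Dirac masses. This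
recovers what is needed of integrality: a charged set carries the mass of a whole point. -/
lemma ae_finitePoisson_one_le {X : Type*} [MeasurableSpace X] (Λ : Measure X)
    [IsFiniteMeasure Λ] {S : Set X} (hS : MeasurableSet S) :
    ∀ᵐ N ∂(finitePoisson Λ), N S ≠ 0 → 1 ≤ N S := by
  have hm : MeasurableSet {N : Measure X | N S ≠ 0 → 1 ≤ N S} :=
    measurableSet_preimage (t := {x | x ≠ 0 → 1 ≤ x}) (Measure.measurable_coe hS)
      ((measurableSet_singleton 0).compl.imp measurableSet_Ici)
  refine Measure.ae_smul_measure ?_ _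
  rw [Measure.ae_sum_iff]
  refine fun n => Measure.ae_smul_measure ?_ _
  rw [ae_map_iff (measurable_sum_dirac n).aemeasurable hm]
  refine ae_of_all _ fun x hx => ?_
  simp only [Measure.coe_finsetSum, Finset.sum_apply, Measure.dirac_apply' _ hS] at hx ⊢
  obtain ⟨i, hi, hxi⟩ := Finset.exists_ne_zero_of_sum_ne_zero hx
  have : x i ∈ S := by by_contra h; simp [h] at hxi
  calc (1 : ℝ≥0∞) = S.indicator 1 (x i) := by simp [this]
    _ ≤ _ := Finset.single_le_sum (f := fun i => S.indicator (1 : X → ℝ≥0∞) (x i))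
      (fun _ _ => zero_le) hi

/-- A Poisson point process has at least one point in each set that it charges. -/
theorem ae_poissonProcess_one_le {X : Type*} [MeasurableSpace X] (Λ : Measure X) [SFinite Λ]
    {S : Set X} (hS : MeasurableSet S) :
    ∀ᵐ N ∂(poissonProcess Λ), N S ≠ 0 → 1 ≤ N S := by
  have hm : MeasurableSet {N : Measure X | N S ≠ 0 → 1 ≤ N S} :=
    measurableSet_preimage (t := {x | x ≠ 0 → 1 ≤ x}) (Measure.measurable_coe hS)
      ((measurableSet_singleton 0).compl.imp measurableSet_Ici)
  rw [poissonProcess, ae_map_iff measurable_measure_sum.aemeasurable hm]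
  have hall : ∀ᵐ N ∂(Measure.infinitePi fun n => finitePoisson (sfiniteSeq Λ n)),
      ∀ i : ℕ, N i S ≠ 0 → 1 ≤ N i S := ae_all_iff.2 fun i =>
    (measurePreserving_eval_infinitePi (fun n => finitePoisson (sfiniteSeq Λ n))
      i).quasiMeasurePreserving.ae (ae_finitePoisson_one_le _ hS)
  filter_upwards [hall] with N hN h
  rw [Measure.sum_apply _ hS] at h ⊢
  obtain ⟨i, hi⟩ : ∃ i, N i S ≠ 0 := by
    by_contra! hc
    exact h (ENNReal.tsum_eq_zero.2 hc)
  exact (hN i hi).trans (ENNReal.le_tsum i)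

/-! ### The fading law -/

lemma isProbabilityMeasure_fadingLaw {m : ℕ} (hm : 1 ≤ m) : IsProbabilityMeasure (fadingLaw m) :=
  isProbabilityMeasure_gammaMeasure (by positivity) (by positivity)

instance nullSingletonClass_fadingLaw (m : ℕ) : NullSingletonClass (fadingLaw m) :=
  ⟨fun x => withDensity_absolutelyContinuous _ _ (by simp)⟩

lemma ae_fadingLaw_nonneg (m : ℕ) : ∀ᵐ h ∂(fadingLaw m), 0 ≤ h := by
  have h : fadingLaw m (Iio 0) = 0 := by
    rw [fadingLaw, gammaMeasure, withDensity_apply _ measurableSet_Iio,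
      lintegral_gammaPDF_of_nonpos le_rfl]
  filter_upwards [measure_eq_zero_iff_ae_notMem.1 h] with x hx
  simpa using hx

lemma fadingLaw_Ioo_pos {m : ℕ} (hm : 1 ≤ m) {a b : ℝ} (ha : 0 ≤ a) (hab : a < b) :
    0 < fadingLaw m (Ioo a b) := by
  have hm' : (0 : ℝ) < m := by positivity
  rw [fadingLaw, gammaMeasure, withDensity_apply _ measurableSet_Ioo,
    setLIntegral_pos_iff (by unfold gammaPDF; fun_prop)]
  have hsub : Ioo a b ⊆ Function.support (gammaPDF m m) ∩ Ioo a b := fun x hx =>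
    ⟨by simpa [gammaPDF] using gammaPDFReal_pos hm' hm' (ha.trans_lt hx.1), hx⟩
  refine lt_of_lt_of_le ?_ (measure_mono hsub)
  simpa using hab

/-- The constant in the bound of the density of the fading law by that of the exponential law. -/
def fadingConst (m : ℕ) : ℝ := (m : ℝ) ^ (m : ℝ) / Real.Gamma m

lemma fadingConst_pos {m : ℕ} (hm : 1 ≤ m) : 0 < fadingConst m :=
  div_pos (by positivity) (Real.Gamma_pos_of_pos (by positivity))

/-- From `x ≤ e^x` one gets `x^{m-1} ≤ e^{(m-1)x}`, which uses up all but one factor `e^{-x}` of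
`e^{-mx}`. -/
lemma gammaPDF_le_exponentialPDF {m : ℕ} (hm : 1 ≤ m) (x : ℝ) :
    gammaPDF m m x ≤ ENNReal.ofReal (fadingConst m) * exponentialPDF 1 x := by
  rcases lt_or_ge x 0 with hx | hx
  · simp [gammaPDF_of_neg hx]
  rw [gammaPDF_of_nonneg hx, exponentialPDF_of_nonneg hx,
    ← ENNReal.ofReal_mul (fadingConst_pos hm).le]
  refine ENNReal.ofReal_le_ofReal ?_
  have hm' : (0 : ℝ) ≤ m - 1 := by simpa using hm
  have h1 : x ^ ((m : ℝ) - 1) ≤ Real.exp (((m : ℝ) - 1) * x) := by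
    rw [mul_comm, Real.exp_mul]
    exact Real.rpow_le_rpow hx (by linarith [Real.add_one_le_exp x]) hm'
  have h2 : Real.exp (-(m * x)) = Real.exp (-(((m : ℝ) - 1) * x)) * Real.exp (-x) := by
    rw [← Real.exp_add]; ring_nf
  rw [h2, one_mul, one_mul, ← mul_assoc, mul_assoc ((m : ℝ) ^ (m : ℝ) / Real.Gamma m)]
  have h3 : x ^ ((m : ℝ) - 1) * Real.exp (-(((m : ℝ) - 1) * x)) ≤ 1 := by
    rw [Real.exp_neg]
    exact mul_inv_le_one_of_le₀ h1 (Real.exp_pos _).le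
  calc _ ≤ (m : ℝ) ^ (m : ℝ) / Real.Gamma m * 1 * Real.exp (-x) := by
        gcongr
    _ = _ := by rw [mul_one, fadingConst]

lemma lintegral_fadingLaw_le {m : ℕ} (hm : 1 ≤ m) {f : ℝ → ℝ≥0∞} (hf : Measurable f) :
    ∫⁻ h, f h ∂(fadingLaw m)
      ≤ ENNReal.ofReal (fadingConst m) * ∫⁻ h, exponentialPDF 1 h * f h := by
  have hmE : Measurable (exponentialPDF 1) :=
    (measurable_exponentialPDFReal 1).ennreal_ofReal
  rw [fadingLaw, gammaMeasure,
    lintegral_withDensity_eq_lintegral_mul _ (by unfold gammaPDF; fun_prop) hf,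
    ← lintegral_const_mul (f := fun h => exponentialPDF 1 h * f h) _ (hmE.mul hf)]
  refine lintegral_mono fun x => ?_
  simp only [Pi.mul_apply]
  rw [← mul_assoc]
  gcongr
  exact gammaPDF_le_exponentialPDF hm x

/-- The form `1 - e^{-t}` is chosen because, with `t` a multiple of the interference, its mean is
one minus a Laplace transform. -/
lemma fadingLaw_Iio_le {m : ℕ} (hm : 1 ≤ m) {t : ℝ} (ht : 0 ≤ t) :
    fadingLaw m (Iio t) ≤ ENNReal.ofReal (fadingConst m * (1 - Real.exp (-t))) := by
  have h := lintegral_fadingLaw_le hm (f := (Iic t).indicator fun _ => 1)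
    (measurable_const.indicator measurableSet_Iic)
  rw [lintegral_indicator_const measurableSet_Iic, one_mul] at h
  refine (measure_mono Iio_subset_Iic_self).trans (h.trans_eq ?_)
  have : ∀ x, exponentialPDF 1 x * (Iic t).indicator (fun _ => 1) x
      = (Iic t).indicator (exponentialPDF 1) x := fun x => by
    by_cases hx : x ∈ Iic t <;> simp [hx, -mem_Iic]
  simp_rw [this]
  rw [lintegral_indicator measurableSet_Iic, lintegral_exponentialPDF_eq_antiDeriv one_pos,
    if_pos ht, one_mul, ← ENNReal.ofReal_mul (fadingConst_pos hm).le]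

lemma lintegral_fadingLaw_lt_top {m : ℕ} (hm : 1 ≤ m) :
    ∫⁻ h, ENNReal.ofReal h ∂(fadingLaw m) < ∞ := by
  refine (lintegral_fadingLaw_le hm ENNReal.measurable_ofReal).trans_lt
    (ENNReal.mul_lt_top ENNReal.ofReal_lt_top ?_)
  have h := Real.GammaIntegral_convergent (s := 2) (by norm_num)
  have h2 := h.setLIntegral_lt_top
  refine lt_of_le_of_lt ?_ h2
  rw [← lintegral_indicator measurableSet_Ioi]
  refine lintegral_mono fun x => ?_
  rcases le_or_gt x 0 with hx | hx
  · simp [ENNReal.ofReal_of_nonpos hx]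
  rw [indicator_of_mem (mem_Ioi.2 hx), exponentialPDF_of_nonneg hx.le,
    ← ENNReal.ofReal_mul (by positivity)]
  norm_num

/-- The mean of a channel power gain. -/
def fadingMean (m : ℕ) : ℝ := (∫⁻ h, ENNReal.ofReal h ∂(fadingLaw m)).toReal

lemma ofReal_fadingMean {m : ℕ} (hm : 1 ≤ m) :
    ENNReal.ofReal (fadingMean m) = ∫⁻ h, ENNReal.ofReal h ∂(fadingLaw m) :=
  ENNReal.ofReal_toReal (lintegral_fadingLaw_lt_top hm).ne

lemma fadingLaw_Ici_pos {m : ℕ} (hm : 1 ≤ m) {q : ℝ} (hq : 0 ≤ q) :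
    0 < (fadingLaw m).real (Ici q) := by
  have := isProbabilityMeasure_fadingLaw hm
  refine ENNReal.toReal_pos (((fadingLaw_Ioo_pos hm hq (lt_add_one q)).trans_le
    (measure_mono ?_)).ne') (measure_ne_top _ _)
  exact fun x hx => hx.1.le

lemma fadingLaw_Iio_pos {m : ℕ} (hm : 1 ≤ m) {q : ℝ} (hq : 0 < q) :
    0 < (fadingLaw m).real (Iio q) := by
  have := isProbabilityMeasure_fadingLaw hm
  refine ENNReal.toReal_pos (((fadingLaw_Ioo_pos hm le_rfl hq).trans_le
    (measure_mono ?_)).ne') (measure_ne_top _ _)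
  exact fun x hx => hx.2

lemma continuous_fadingLaw_Iio {m : ℕ} (hm : 1 ≤ m) :
    Continuous fun t => (fadingLaw m).real (Iio t) := by
  have := isProbabilityMeasure_fadingLaw hm
  refine continuous_iff_continuousAt.2 fun t₀ => (ENNReal.tendsto_toReal (measure_ne_top _ _)).comp
    (tendsto_measure_of_ae_tendsto_indicator_of_isFiniteMeasure (𝓝 t₀) measurableSet_Iio
      (fun _ => measurableSet_Iio) ?_)
  have hne : ∀ᵐ h ∂(fadingLaw m), h ≠ t₀ := by simp [ae_iff]
  filter_upwards [hne] with h hh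
  rcases hh.lt_or_gt with hlt | hlt
  · filter_upwards [eventually_gt_nhds hlt] with t ht
    simp [hlt, ht]
  · filter_upwards [eventually_lt_nhds hlt] with t ht
    simp [hlt.not_gt, ht.not_gt]

lemma tendsto_fadingLaw_Iio_atTop {m : ℕ} (hm : 1 ≤ m) :
    Tendsto (fun t => (fadingLaw m).real (Iio t)) atTop (𝓝 1) := by
  have := isProbabilityMeasure_fadingLaw hm
  have h : ∀ t, (fadingLaw m).real (Iio t) = cdf (fadingLaw m) t := fun t => by
    rw [cdf_eq_real, measureReal_def, measureReal_def, measure_congr Iio_ae_eq_Iic]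
  simp_rw [h]
  exact tendsto_cdf_atTop _

/-! ### The law of the interference -/

/-- The intensity measure of the marked interferers. -/
abbrev markedIntensity (d m : ℕ) (lam : ℝ) : Measure (EuclideanSpace ℝ (Fin d) × ℝ) :=
  (ENNReal.ofReal lam • (volume : Measure (EuclideanSpace ℝ (Fin d)))).prod (fadingLaw m)

/-- The contribution of an interferer to the interference. -/
def contribution {d : ℕ} (α : ℝ) (p : EuclideanSpace ℝ (Fin d) × ℝ) : ℝ≥0∞ :=
  ENNReal.ofReal (p.2 * pathLoss α p.1)

/-- The Laplace exponent of the interference for unit intensity. -/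
def laplaceExponent (d : ℕ) (α : ℝ) (m : ℕ) (t : ℝ) : ℝ≥0∞ :=
  ∫⁻ p : EuclideanSpace ℝ (Fin d) × ℝ, (1 - negExp (ENNReal.ofReal t * contribution α p))
    ∂((volume : Measure (EuclideanSpace ℝ (Fin d))).prod (fadingLaw m))

lemma measurable_pathLoss {d : ℕ} (α : ℝ) : Measurable (pathLoss (d := d) α) :=
  Measurable.ite (measurableSet_le measurable_const measurable_norm)
    (measurable_norm.pow_const _) measurable_const

lemma measurable_contribution {d : ℕ} (α : ℝ) : Measurable (contribution (d := d) α) :=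
  (measurable_snd.mul ((measurable_pathLoss α).comp measurable_fst)).ennreal_ofReal

lemma lintegral_negExp_contribution {d : ℕ} (α : ℝ) (m : ℕ) (lam t : ℝ) :
    ∫⁻ N, negExp (ENNReal.ofReal t * ∫⁻ p, contribution α p ∂N)
      ∂(poissonProcess (markedIntensity d m lam))
      = negExp (ENNReal.ofReal lam * laplaceExponent d α m t) := by
  simp_rw [← lintegral_const_mul _ (measurable_contribution α)]
  rw [lintegral_negExp_poissonProcess _ ((measurable_contribution α).const_mul _),
    markedIntensity, Measure.prod_smul_left, lintegral_smul_measure, smul_eq_mul, laplaceExponent]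

lemma pathLoss_nonneg {d : ℕ} (α : ℝ) (x : EuclideanSpace ℝ (Fin d)) : 0 ≤ pathLoss α x := by
  unfold pathLoss; split_ifs <;> positivity

lemma pathLoss_le {d : ℕ} (α : ℝ) (x : EuclideanSpace ℝ (Fin d)) :
    pathLoss α x ≤ ‖x‖ ^ (-α) := by
  unfold pathLoss; split_ifs
  · exact le_rfl
  · positivity

/-- Replaces the capped power by the kernel `(1 + r)^{-α}`, which is integrable on `ℝ^d` for `α >
d`. -/
lemma min_one_rpow_neg_le {α r : ℝ} (hα : 0 < α) (hr : 0 ≤ r) :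
    min 1 (r ^ (-α)) ≤ 2 ^ α * (1 + r) ^ (-α) := by
  rw [Real.rpow_neg (by positivity : (0 : ℝ) ≤ 1 + r), ← div_eq_mul_inv,
    ← Real.div_rpow (by norm_num) (by positivity)]
  rcases le_total r 1 with h | h
  · refine (min_le_left _ _).trans (Real.one_le_rpow ?_ hα.le)
    rw [le_div_iff₀ (by positivity)]; linarith
  · refine (min_le_right _ _).trans ?_
    rw [Real.rpow_neg hr, ← Real.inv_rpow hr]
    refine Real.rpow_le_rpow (by positivity) ?_ hα.le
    rw [inv_eq_one_div, div_le_div_iff₀ (by positivity) (by positivity)]; linarith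

lemma lintegral_comp_smul {d : ℕ} {f : EuclideanSpace ℝ (Fin d) → ℝ≥0∞} (hf : Measurable f)
    {r : ℝ} (hr : 0 < r) :
    ∫⁻ x, f (r • x) = ENNReal.ofReal ((r ^ d)⁻¹) * ∫⁻ x, f x := by
  rw [← lintegral_map hf (measurable_const_smul r), Measure.map_addHaar_smul _ hr.ne',
    lintegral_smul_measure, smul_eq_mul, finrank_euclideanSpace_fin,
    abs_of_pos (by positivity)]

/-- An interferer at `x` contributes at most `min(1, t |x|^{-α} E H)`. This is a function of
`t^{-1/α} x`, so the change of variables produces the factor `t^{d/α}`; the remaining integral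
converges at infinity because `α > d`. Truncating the path loss only helps. -/
lemma laplaceExponent_le {d : ℕ} {α : ℝ} (hd : 1 ≤ d) (hα : (d : ℝ) < α) {m : ℕ} (hm : 1 ≤ m) :
    ∃ K : ℝ, 0 < K ∧ ∀ t : ℝ, 0 < t →
      laplaceExponent d α m t ≤ ENNReal.ofReal (K * t ^ ((d : ℝ) / α)) := by
  have := isProbabilityMeasure_fadingLaw hm
  have hα0 : 0 < α := lt_of_le_of_lt (by positivity) hα
  set J := ∫⁻ x : EuclideanSpace ℝ (Fin d), ENNReal.ofReal ((1 + ‖x‖) ^ (-α)) with hJ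
  have hJfin : J < ∞ := finite_integral_one_add_norm (by simpa using hα)
  have hM0 : 0 ≤ fadingMean m := ENNReal.toReal_nonneg
  obtain ⟨j, hj0, hj⟩ : ∃ j : ℝ, 0 ≤ j ∧ J = ENNReal.ofReal j :=
    ⟨J.toReal, ENNReal.toReal_nonneg, (ENNReal.ofReal_toReal hJfin.ne).symm⟩
  -- Using `j + 1` in place of `j` makes the constant positive without showing that the kernel has
  -- positive integral.
  refine ⟨(1 + fadingMean m) * 2 ^ α * (j + 1), by positivity, fun t ht => ?_⟩
  have hmeas : Measurable fun p : EuclideanSpace ℝ (Fin d) × ℝ =>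
      1 - negExp (ENNReal.ofReal t * contribution α p) :=
    (measurable_negExp.comp ((measurable_contribution α).const_mul _)).const_sub 1
  rw [laplaceExponent, lintegral_prod _ hmeas.aemeasurable]
  have hpt : ∀ x : EuclideanSpace ℝ (Fin d),
      ∫⁻ h, (1 - negExp (ENNReal.ofReal t * contribution α (x, h))) ∂(fadingLaw m)
        ≤ ENNReal.ofReal ((1 + fadingMean m) * 2 ^ α) *
          ENNReal.ofReal ((1 + ‖t ^ (-(1 / α)) • x‖) ^ (-α)) := by
    intro x
    have hl0 := pathLoss_nonneg α x
    have h1 : ∫⁻ h, (1 - negExp (ENNReal.ofReal t * contribution α (x, h))) ∂(fadingLaw m) ≤ 1 := by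
      calc _ ≤ ∫⁻ _, 1 ∂(fadingLaw m) := lintegral_mono fun h => tsub_le_self
        _ = 1 := by simp
    have h2 : ∫⁻ h, (1 - negExp (ENNReal.ofReal t * contribution α (x, h))) ∂(fadingLaw m)
        ≤ ENNReal.ofReal (t * ‖x‖ ^ (-α) * fadingMean m) := by
      calc _ ≤ ∫⁻ h, ENNReal.ofReal (t * ‖x‖ ^ (-α)) * ENNReal.ofReal h ∂(fadingLaw m) := by
            refine lintegral_mono_ae ?_
            filter_upwards [ae_fadingLaw_nonneg m] with h hh
            refine (one_sub_negExp_le _).trans ?_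
            rw [contribution, ← ENNReal.ofReal_mul ht.le, ← ENNReal.ofReal_mul (by positivity)]
            refine ENNReal.ofReal_le_ofReal ?_
            have := pathLoss_le α x
            calc t * (h * pathLoss α x) = t * pathLoss α x * h := by ring
              _ ≤ _ := by gcongr
        _ = _ := by
          rw [lintegral_const_mul _ ENNReal.measurable_ofReal, ← ofReal_fadingMean hm,
            ← ENNReal.ofReal_mul (by positivity)]
    have h3 : ‖t ^ (-(1 / α)) • x‖ ^ (-α) = t * ‖x‖ ^ (-α) := by
      rw [norm_smul, Real.norm_of_nonneg (by positivity), Real.mul_rpow (by positivity)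
        (by positivity), ← Real.rpow_mul ht.le, neg_mul_neg, one_div_mul_cancel hα0.ne',
        Real.rpow_one]
    rw [← ENNReal.ofReal_mul (by positivity)]
    refine (le_min h1 h2).trans ?_
    rw [← ENNReal.ofReal_one, ← ENNReal.ofReal_min]
    refine ENNReal.ofReal_le_ofReal ?_
    have h4 := min_one_rpow_neg_le hα0 (norm_nonneg (t ^ (-(1 / α)) • x))
    rw [h3] at h4
    have h5 : 0 ≤ t * ‖x‖ ^ (-α) := by positivity
    calc min 1 (t * ‖x‖ ^ (-α) * fadingMean m)
        ≤ (1 + fadingMean m) * min 1 (t * ‖x‖ ^ (-α)) := by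
          rcases le_total 1 (t * ‖x‖ ^ (-α)) with h | h
          · rw [min_eq_left h]; exact (min_le_left _ _).trans (by linarith)
          · rw [min_eq_right h]; exact (min_le_right _ _).trans (by nlinarith)
      _ ≤ (1 + fadingMean m) * (2 ^ α * (1 + ‖t ^ (-(1 / α)) • x‖) ^ (-α)) := by gcongr
      _ = _ := by ring
  refine (lintegral_mono hpt).trans ?_
  have hgm : Measurable fun x : EuclideanSpace ℝ (Fin d) =>
      ENNReal.ofReal ((1 + ‖x‖) ^ (-α)) := by fun_prop
  rw [lintegral_const_mul _ (by fun_prop), lintegral_comp_smul hgm (by positivity), ← hJ,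
    hj, ← ENNReal.ofReal_mul (by positivity),
    ← ENNReal.ofReal_mul (by positivity)]
  refine ENNReal.ofReal_le_ofReal ?_
  have h6 : ((t ^ (-(1 / α))) ^ d)⁻¹ = t ^ ((d : ℝ) / α) := by
    rw [← Real.rpow_natCast, ← Real.rpow_mul ht.le, ← Real.rpow_neg ht.le]
    congr 1; field_simp
  rw [h6, mul_assoc _ (j + 1), mul_comm (j + 1)]
  gcongr
  linarith

/-- Where the sum is infinite, `1 - e^{-tT} = 1` for every `t > 0`, so the probability is at most
the mean of `1 - e^{-tT}`, which vanishes as `t → 0`. This matters because `interference` applies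
`toReal`, which would send an infinite sum to `0`. -/
lemma ae_lintegral_contribution_lt_top {d : ℕ} {α : ℝ} (hd : 1 ≤ d) (hα : (d : ℝ) < α) {m : ℕ}
    (hm : 1 ≤ m) (lam : ℝ) :
    ∀ᵐ N ∂(poissonProcess (markedIntensity d m lam)), ∫⁻ p, contribution α p ∂N < ∞ := by
  obtain ⟨K, hK, hKt⟩ := laplaceExponent_le hd hα hm
  have hα0 : 0 < α := lt_of_le_of_lt (by positivity) hα
  have hd0 : (0 : ℝ) < d := by positivity
  set T := fun N : Measure (EuclideanSpace ℝ (Fin d) × ℝ) => ∫⁻ p, contribution α p ∂N with hT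
  have hTm : Measurable T := Measure.measurable_lintegral (measurable_contribution α)
  have hbound : ∀ t : ℝ, 0 < t → poissonProcess (markedIntensity d m lam) {N | T N = ∞}
      ≤ ENNReal.ofReal lam * ENNReal.ofReal (K * t ^ ((d : ℝ) / α)) := by
    intro t ht
    have hmeas : Measurable fun N => negExp (ENNReal.ofReal t * T N) :=
      measurable_negExp.comp (hTm.const_mul _)
    have hset : MeasurableSet {N | T N = ∞} := hTm (measurableSet_singleton ∞)
    calc poissonProcess (markedIntensity d m lam) {N | T N = ∞}
        = ∫⁻ N, {N | T N = ∞}.indicator 1 N ∂(poissonProcess (markedIntensity d m lam)) := by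
          rw [lintegral_indicator_one hset]
      _ ≤ ∫⁻ N, (1 - negExp (ENNReal.ofReal t * T N))
            ∂(poissonProcess (markedIntensity d m lam)) := by
          refine lintegral_mono fun N => ?_
          by_cases h : T N = ∞
          · simp [h, ENNReal.mul_top (ENNReal.ofReal_pos.2 ht).ne']
          · simp [h]
      _ = 1 - negExp (ENNReal.ofReal lam * laplaceExponent d α m t) := by
          rw [lintegral_sub hmeas _ (ae_of_all _ fun N => negExp_le_one _),
            lintegral_negExp_contribution]
          · simp
          · rw [lintegral_negExp_contribution]
            exact ((negExp_le_one _).trans_lt ENNReal.one_lt_top).ne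
      _ ≤ ENNReal.ofReal lam * laplaceExponent d α m t := one_sub_negExp_le _
      _ ≤ _ := by gcongr; exact hKt t ht
  have hlim : Tendsto (fun t : ℝ => ENNReal.ofReal lam * ENNReal.ofReal (K * t ^ ((d : ℝ) / α)))
      (𝓝[>] 0) (𝓝 0) := by
    have h1 : Tendsto (fun t : ℝ => K * t ^ ((d : ℝ) / α)) (𝓝[>] 0) (𝓝 0) := by
      have := ((Real.continuous_rpow_const (q := (d : ℝ) / α) (by positivity)).tendsto 0).const_mul K
      rw [Real.zero_rpow (by positivity), mul_zero] at this
      exact this.mono_left nhdsWithin_le_nhds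
    have h2 := ENNReal.Tendsto.const_mul (a := ENNReal.ofReal lam)
      ((ENNReal.continuous_ofReal.tendsto _).comp h1) (Or.inr ENNReal.ofReal_ne_top)
    simpa using h2
  have hzero : poissonProcess (markedIntensity d m lam) {N | T N = ∞} = 0 :=
    le_antisymm (ge_of_tendsto hlim (eventually_nhdsWithin_of_forall fun t ht => hbound t ht))
      zero_le
  filter_upwards [measure_eq_zero_iff_ae_notMem.1 hzero] with N hN
  exact lt_top_iff_ne_top.2 hN

lemma interference_eq {d : ℕ} (α : ℝ) (N : Measure (EuclideanSpace ℝ (Fin d) × ℝ)) :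
    interference α N = (∫⁻ p, contribution α p ∂N).toReal := rfl

lemma ae_interferenceLaw_nonneg (d : ℕ) (α : ℝ) (m : ℕ) (lam : ℝ) :
    ∀ᵐ x ∂(interferenceLaw d α m lam), 0 ≤ x := by
  rw [interferenceLaw, ae_map_iff (measurable_interference α).aemeasurable measurableSet_Ici]
  exact ae_of_all _ fun N => ENNReal.toReal_nonneg

/-- The Laplace transform of the interference. -/
lemma lintegral_exp_interferenceLaw {d : ℕ} {α : ℝ} (hd : 1 ≤ d) (hα : (d : ℝ) < α) {m : ℕ}
    (hm : 1 ≤ m) (lam : ℝ) {t : ℝ} (ht : 0 ≤ t) :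
    ∫⁻ x, ENNReal.ofReal (Real.exp (-(t * x))) ∂(interferenceLaw d α m lam)
      = negExp (ENNReal.ofReal lam * laplaceExponent d α m t) := by
  rw [← lintegral_negExp_contribution, interferenceLaw,
    lintegral_map (by fun_prop) (measurable_interference α)]
  refine lintegral_congr_ae ?_
  filter_upwards [ae_lintegral_contribution_lt_top hd hα hm lam] with N hN
  rw [interference_eq, ← negExp_ofReal (by positivity), ENNReal.ofReal_mul ht,
    ENNReal.ofReal_toReal hN.ne]

lemma lintegral_one_sub_exp_interferenceLaw_le {d : ℕ} {α : ℝ} (hd : 1 ≤ d) (hα : (d : ℝ) < α)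
    {m : ℕ} (hm : 1 ≤ m) :
    ∃ K : ℝ, 0 < K ∧ ∀ lam t : ℝ, 0 ≤ lam → 0 < t →
      ∫⁻ x, ENNReal.ofReal (1 - Real.exp (-(t * x))) ∂(interferenceLaw d α m lam)
        ≤ ENNReal.ofReal (K * lam * t ^ ((d : ℝ) / α)) := by
  obtain ⟨K, hK, hKt⟩ := laplaceExponent_le hd hα hm
  refine ⟨K, hK, fun lam t hlam ht => ?_⟩
  have h1 : ∀ x : ℝ, ENNReal.ofReal (1 - Real.exp (-(t * x)))
      = 1 - ENNReal.ofReal (Real.exp (-(t * x))) := fun x => by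
    rw [ENNReal.ofReal_sub _ (Real.exp_pos _).le, ENNReal.ofReal_one]
  have h2 := lintegral_exp_interferenceLaw hd hα hm lam ht.le
  simp_rw [h1]
  rw [lintegral_sub (by fun_prop), h2, lintegral_one, measure_univ]
  · calc _ ≤ ENNReal.ofReal lam * laplaceExponent d α m t := one_sub_negExp_le _
      _ ≤ ENNReal.ofReal lam * ENNReal.ofReal (K * t ^ ((d : ℝ) / α)) := by
        gcongr; exact hKt t ht
      _ = _ := by rw [← ENNReal.ofReal_mul hlam]; congr 1; ring
  · rw [h2]
    exact ((negExp_le_one _).trans_lt ENNReal.one_lt_top).ne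
  · filter_upwards [ae_interferenceLaw_nonneg d α m lam] with x hx
    rw [ENNReal.ofReal_le_one, Real.exp_le_one_iff, neg_nonpos]
    positivity

/-- Markov's inequality for `1 - e^{-I/a}`, which is at least `1/2` once `I ≥ a`. -/
lemma interferenceLaw_Ici_le {d : ℕ} {α : ℝ} (hd : 1 ≤ d) (hα : (d : ℝ) < α)
    {m : ℕ} (hm : 1 ≤ m) :
    ∃ K : ℝ, 0 < K ∧ ∀ lam a : ℝ, 0 ≤ lam → 0 < a →
      (interferenceLaw d α m lam).real (Ici a) ≤ K * lam * a ^ (-((d : ℝ) / α)) := by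
  obtain ⟨K, hK, hKt⟩ := lintegral_one_sub_exp_interferenceLaw_le hd hα hm
  refine ⟨2 * K, by positivity, fun lam a hlam ha => ?_⟩
  have h := hKt lam a⁻¹ hlam (by positivity)
  have h1 := mul_meas_ge_le_lintegral (μ := interferenceLaw d α m lam)
    (f := fun x => ENNReal.ofReal (1 - Real.exp (-(a⁻¹ * x)))) (by fun_prop)
    (ENNReal.ofReal (1 / 2))
  have h2 : interferenceLaw d α m lam (Ici a) ≤ interferenceLaw d α m lam
      {x | ENNReal.ofReal (1 / 2) ≤ ENNReal.ofReal (1 - Real.exp (-(a⁻¹ * x)))} := by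
    refine measure_mono fun x hx => ENNReal.ofReal_le_ofReal ?_
    have h3 : 1 ≤ a⁻¹ * x := by
      rw [inv_mul_eq_div, le_div_iff₀ ha, one_mul]; exact hx
    have h4 : Real.exp (-(a⁻¹ * x)) ≤ 1 / 2 := by
      refine (Real.exp_le_exp.2 (neg_le_neg h3)).trans ?_
      rw [Real.exp_neg, one_div]
      refine inv_anti₀ (by norm_num) ?_
      linarith [Real.add_one_le_exp 1]
    linarith
  have h5 : ENNReal.ofReal (1 / 2) * interferenceLaw d α m lam (Ici a)
      ≤ ENNReal.ofReal (K * lam * a⁻¹ ^ ((d : ℝ) / α)) :=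
    (mul_le_mul_right h2 _).trans (h1.trans h)
  have h6 := ENNReal.toReal_mono ENNReal.ofReal_ne_top h5
  rw [ENNReal.toReal_mul, ENNReal.toReal_ofReal (by norm_num),
    ENNReal.toReal_ofReal (by positivity), Real.inv_rpow ha.le, ← Real.rpow_neg ha.le] at h6
  rw [measureReal_def]
  linarith

/-- The volume of the unit ball. -/
def unitVolume (d : ℕ) : ℝ := (volume : Measure (EuclideanSpace ℝ (Fin d))).real (Metric.ball 0 1)

lemma unitVolume_pos (d : ℕ) : 0 < unitVolume d :=
  ENNReal.toReal_pos (Metric.measure_ball_pos _ _ one_pos).ne' measure_ball_lt_top.ne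

lemma volume_closedBall {d : ℕ} {r : ℝ} (hr : 0 ≤ r) :
    volume (Metric.closedBall (0 : EuclideanSpace ℝ (Fin d)) r)
      = ENNReal.ofReal (r ^ d * unitVolume d) := by
  rw [Measure.addHaar_closedBall _ _ hr, finrank_euclideanSpace_fin,
    ENNReal.ofReal_mul (by positivity), unitVolume, measureReal_def,
    ENNReal.ofReal_toReal measure_ball_lt_top.ne]

lemma volume_annulus {d : ℕ} {r R : ℝ} (hr : 0 ≤ r) (hrR : r ≤ R) :
    volume (Metric.closedBall (0 : EuclideanSpace ℝ (Fin d)) R \ Metric.closedBall 0 r)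
      = ENNReal.ofReal ((R ^ d - r ^ d) * unitVolume d) := by
  have := unitVolume_pos d
  rw [measure_sdiff (Metric.closedBall_subset_closedBall hrR)
    Metric.isClosed_closedBall.measurableSet.nullMeasurableSet measure_closedBall_lt_top.ne,
    volume_closedBall hr, volume_closedBall (hr.trans hrR), ← ENNReal.ofReal_sub _ (by positivity),
    sub_mul]

/-- Small values of the interference are unlikely: a single close interferer exceeds them. -/
lemma interferenceLaw_Iio_le {d : ℕ} {α : ℝ} (hd : 1 ≤ d) (hα : (d : ℝ) < α) {m : ℕ} (hm : 1 ≤ m)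
    {lam q a : ℝ} (hlam : 0 ≤ lam) (hq : 0 < q) (ha : 0 < a)
    (hqa : 2 ≤ (q / a) ^ ((d : ℝ) / α)) :
    (interferenceLaw d α m lam).real (Iio a)
      ≤ Real.exp (-(lam * (unitVolume d * (fadingLaw m).real (Ici q) / 2 *
          (q / a) ^ ((d : ℝ) / α)))) := by
  have := isProbabilityMeasure_fadingLaw hm
  have hα0 : 0 < α := lt_of_le_of_lt (by positivity) hα
  have hd0 : (0 : ℝ) < d := by positivity
  have hV := unitVolume_pos d
  -- `R` is the distance at which an interferer of gain `q` contributes exactly `a`.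
  set R := (q / a) ^ (1 / α) with hR
  have hRd : R ^ d = (q / a) ^ ((d : ℝ) / α) := by
    rw [hR, ← Real.rpow_natCast, ← Real.rpow_mul (by positivity)]; congr 1; ring
  have hRα : R ^ (-α) = a / q := by
    rw [hR, ← Real.rpow_mul (by positivity), mul_neg, one_div_mul_cancel hα0.ne', Real.rpow_neg_one,
      inv_div]
  have hR0 : 0 < R := by positivity
  have hR1 : 1 ≤ R := by
    by_contra! h
    have := pow_le_one₀ (n := d) hR0.le h.le
    linarith
  set S : Set (EuclideanSpace ℝ (Fin d) × ℝ) := {p | ENNReal.ofReal a ≤ contribution α p} with hS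
  have hSm : MeasurableSet S := measurableSet_le measurable_const (measurable_contribution α)
  have hsub : (Metric.closedBall (0 : EuclideanSpace ℝ (Fin d)) R \ Metric.closedBall 0 1) ×ˢ
      Ici q ⊆ S := by
    rintro ⟨x, h⟩ ⟨⟨hx1, hx2⟩, hh⟩
    simp only [mem_Ici, Metric.mem_closedBall, dist_zero_right, not_le] at hx1 hx2 hh
    refine ENNReal.ofReal_le_ofReal ?_
    rw [pathLoss, if_pos hx2.le]
    calc a = q * R ^ (-α) := by rw [hRα]; field_simp
      _ ≤ h * ‖x‖ ^ (-α) := mul_le_mul hh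
        (Real.rpow_le_rpow_of_nonpos (by linarith) hx1 (by linarith)) (by positivity) (by linarith)
  -- The truncation removes the unit ball, leaving volume proportional to `R^d - 1`; the hypothesis
  -- `R^d ≥ 2` makes this at least `R^d / 2`.
  have hΛ : ENNReal.ofReal (lam * (unitVolume d * (fadingLaw m).real (Ici q) / 2 *
      (q / a) ^ ((d : ℝ) / α))) ≤ markedIntensity d m lam S := by
    refine le_trans ?_ (measure_mono hsub)
    rw [markedIntensity, Measure.prod_prod, Measure.smul_apply, smul_eq_mul,
      volume_annulus zero_le_one hR1, ← ENNReal.ofReal_mul hlam,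
      ← ENNReal.ofReal_toReal (measure_ne_top (fadingLaw m) (Ici q)),
      ← ENNReal.ofReal_mul (mul_nonneg hlam (mul_nonneg (by rw [one_pow, hRd]; linarith) hV.le)),
      one_pow, hRd]
    refine ENNReal.ofReal_le_ofReal ?_
    change _ ≤ _ * (fadingLaw m).real (Ici q)
    have hF : 0 ≤ (fadingLaw m).real (Ici q) := measureReal_nonneg
    have h1 : lam * unitVolume d * (fadingLaw m).real (Ici q) * ((q / a) ^ ((d : ℝ) / α) / 2)
        ≤ lam * unitVolume d * (fadingLaw m).real (Ici q) * ((q / a) ^ ((d : ℝ) / α) - 1) := by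
      gcongr; linarith
    linarith
  have hle : interferenceLaw d α m lam (Iio a)
      ≤ poissonProcess (markedIntensity d m lam) {N | N S = 0} := by
    rw [interferenceLaw, Measure.map_apply (measurable_interference α) measurableSet_Iio]
    refine measure_mono_ae ?_
    filter_upwards [ae_poissonProcess_one_le (markedIntensity d m lam) hSm,
      ae_lintegral_contribution_lt_top hd hα hm lam] with N hN1 hN2 hN3
    by_contra h0
    have h1 := hN1 h0
    have h2 := mul_meas_ge_le_lintegral (μ := N) (measurable_contribution α) (ENNReal.ofReal a)
    have h3 : ENNReal.ofReal a ≤ ∫⁻ p, contribution α p ∂N :=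
      le_trans (by simpa using mul_le_mul_right h1 (ENNReal.ofReal a)) h2
    have h4 : a ≤ interference α N := by
      rw [interference_eq]; exact (ENNReal.ofReal_le_iff_le_toReal hN2.ne).1 h3
    exact absurd hN3 (not_lt.2 h4)
  rw [poissonProcess_void _ hSm] at hle
  have hanti : negExp (markedIntensity d m lam S) ≤ negExp (ENNReal.ofReal
      (lam * (unitVolume d * (fadingLaw m).real (Ici q) / 2 * (q / a) ^ ((d : ℝ) / α)))) := by
    unfold negExp
    exact EReal.exp_monotone (EReal.neg_le_neg_iff.2 (EReal.coe_ennreal_le_coe_ennreal_iff.2 hΛ))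
  rw [negExp_ofReal (by positivity)] at hanti
  exact ENNReal.toReal_le_of_le_ofReal (Real.exp_pos _).le (hle.trans hanti)

/-! ### Continuous dependence of the interference on the intensity -/

lemma continuous_integral_exp_interferenceLaw {d : ℕ} {α : ℝ} (hd : 1 ≤ d) (hα : (d : ℝ) < α)
    {m : ℕ} (hm : 1 ≤ m) {t : ℝ} (ht : 0 ≤ t) :
    Continuous fun lam => ∫ x, Real.exp (-(t * x)) ∂(interferenceLaw d α m lam) := by
  have hfin : laplaceExponent d α m t ≠ ∞ := by
    rcases ht.eq_or_lt with rfl | ht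
    · simp [laplaceExponent]
    · obtain ⟨K, -, hK⟩ := laplaceExponent_le hd hα hm
      exact ((hK t ht).trans_lt ENNReal.ofReal_lt_top).ne
  have h : ∀ lam, ∫ x, Real.exp (-(t * x)) ∂(interferenceLaw d α m lam)
      = (negExp (ENNReal.ofReal lam * laplaceExponent d α m t)).toReal := fun lam => by
    rw [← lintegral_exp_interferenceLaw hd hα hm lam ht,
      integral_eq_lintegral_of_nonneg_ae (ae_of_all _ fun x => (Real.exp_pos _).le)
        (by fun_prop)]
  simp_rw [h]
  refine ENNReal.continuousOn_toReal.comp_continuous (continuous_negExp.comp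
    ((ENNReal.continuous_mul_const hfin).comp ENNReal.continuous_ofReal)) fun lam => ?_
  exact ((negExp_le_one _).trans_lt ENNReal.one_lt_top).ne

lemma continuous_integral_polynomial_interferenceLaw {d : ℕ} {α : ℝ} (hd : 1 ≤ d)
    (hα : (d : ℝ) < α) {m : ℕ} (hm : 1 ≤ m) (p : Polynomial ℝ) :
    Continuous fun lam => ∫ x, p.eval (Real.exp (-x)) ∂(interferenceLaw d α m lam) := by
  have hint : ∀ (lam : ℝ) (n : ℕ), Integrable (fun x : ℝ => p.coeff n * Real.exp (-x) ^ n)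
      (interferenceLaw d α m lam) := fun lam n => by
    refine Integrable.const_mul (Integrable.of_bound (by fun_prop) 1 ?_) _
    filter_upwards [ae_interferenceLaw_nonneg d α m lam] with x hx
    rw [Real.norm_of_nonneg (by positivity)]
    exact pow_le_one₀ (by positivity) (Real.exp_le_one_iff.2 (by linarith))
  simp_rw [Polynomial.eval_eq_sum_range]
  simp_rw [fun lam => integral_finsetSum (μ := interferenceLaw d α m lam)
    (Finset.range (p.natDegree + 1)) (fun n _ => hint lam n)]
  refine continuous_finsetSum _ fun n _ => ?_
  simp_rw [integral_const_mul, ← Real.exp_nat_mul, mul_neg]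
  exact (continuous_integral_exp_interferenceLaw hd hα hm n.cast_nonneg).const_mul _

/-- The substitution `u = e^{-x}` compactifies `[0, ∞]` to `[0, 1]`, where Weierstrass approximates
by polynomials. A polynomial in `e^{-x}` integrates to a combination of Laplace transforms at
natural numbers, each continuous in `lam`, and the approximation is uniform in `lam`. -/
lemma continuous_integral_interferenceLaw {d : ℕ} {α : ℝ} (hd : 1 ≤ d) (hα : (d : ℝ) < α) {m : ℕ}
    (hm : 1 ≤ m) {F : ℝ → ℝ} (hF : Continuous F) {L : ℝ} (hL : Tendsto F atTop (𝓝 L)) :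
    Continuous fun lam => ∫ x, F x ∂(interferenceLaw d α m lam) := by
  classical
  -- The point `u = 0` stands for `x = ∞`; the constant extension to `u < 0` makes `g` continuous on
  -- the whole line.
  let g : ℝ → ℝ := fun u => if u ≤ 0 then L else F (-Real.log u)
  have hg : Continuous g := by
    refine continuous_iff_continuousAt.2 fun u => ?_
    rcases lt_trichotomy u 0 with hu | rfl | hu
    · refine (continuousAt_const (y := L)).congr ?_
      filter_upwards [eventually_lt_nhds hu] with v hv
      simp [g, hv.le]
    · have h1 : ContinuousWithinAt g (Iic 0) 0 :=
        (continuousWithinAt_const (b := L)).congr (fun v hv => by simp [g, mem_Iic.1 hv])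
          (by simp [g])
      have h2 : ContinuousWithinAt g (Ioi 0) 0 := by
        have h3 : Tendsto (fun u => F (-Real.log u)) (𝓝[>] 0) (𝓝 L) :=
          hL.comp (tendsto_neg_atBot_atTop.comp Real.tendsto_log_nhdsGT_zero)
        have h4 : g 0 = L := by simp [g]
        rw [ContinuousWithinAt, h4]
        refine h3.congr' (eventually_nhdsWithin_of_forall fun v hv => ?_)
        simp [g, not_le.2 (mem_Ioi.1 hv)]
      have h5 := h1.union h2
      rwa [Iic_union_Ioi, continuousWithinAt_univ] at h5
    · have h1 : ContinuousAt (fun u => F (-Real.log u)) u :=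
        hF.continuousAt.comp (Real.continuousAt_log hu.ne').neg
      refine h1.congr ?_
      filter_upwards [eventually_gt_nhds hu] with v hv
      simp [g, not_le.2 hv]
  have hgF : ∀ x, g (Real.exp (-x)) = F x := fun x => by
    simp [g, not_le.2 (Real.exp_pos _)]
  obtain ⟨B, hB⟩ := isCompact_Icc (a := (0 : ℝ)) (b := 1) |>.exists_bound_of_continuousOn
    hg.continuousOn
  have hexp : ∀ lam, ∀ᵐ x ∂(interferenceLaw d α m lam), Real.exp (-x) ∈ Icc (0 : ℝ) 1 := fun lam => by
    filter_upwards [ae_interferenceLaw_nonneg d α m lam] with x hx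
    exact ⟨(Real.exp_pos _).le, Real.exp_le_one_iff.2 (by linarith)⟩
  have hFint : ∀ lam, Integrable F (interferenceLaw d α m lam) := fun lam => by
    refine Integrable.of_bound hF.aestronglyMeasurable B ?_
    filter_upwards [hexp lam] with x hx
    rw [← hgF x]; exact hB _ hx
  refine continuous_of_uniform_approx_of_continuous fun u hu => ?_
  obtain ⟨ε, hε, hεu⟩ := Metric.mem_uniformity_dist.1 hu
  obtain ⟨p, hp⟩ := exists_polynomial_near_continuousMap 0 1
    ((ContinuousMap.mk g hg).restrict (Icc 0 1)) (ε / 2) (by positivity)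
  refine ⟨_, continuous_integral_polynomial_interferenceLaw hd hα hm p, fun lam => hεu ?_⟩
  have hnear : ∀ᵐ x ∂(interferenceLaw d α m lam), ‖F x - p.eval (Real.exp (-x))‖ ≤ ε / 2 := by
    filter_upwards [hexp lam] with x hx
    have h := (ContinuousMap.norm_coe_le_norm (p.toContinuousMapOn (Icc 0 1) -
      (ContinuousMap.mk g hg).restrict (Icc 0 1)) ⟨_, hx⟩).trans hp.le
    rw [norm_sub_rev, ← hgF x]
    simpa using h
  have hpint : Integrable (fun x => p.eval (Real.exp (-x))) (interferenceLaw d α m lam) := by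
    have h1 : Integrable (fun x => F x - p.eval (Real.exp (-x))) (interferenceLaw d α m lam) :=
      Integrable.of_bound (by fun_prop) _ hnear
    exact ((hFint lam).sub h1).congr (ae_of_all _ fun x => by simp)
  rw [Real.dist_eq, ← integral_sub (hFint lam) hpint, ← Real.norm_eq_abs]
  have := norm_integral_le_of_norm_le_const hnear
  rw [probReal_univ, mul_one] at this
  linarith

/-! ### The failure probability of a single attempt -/

/-- The probability that an attempt fails at a receiver, where `θ = β ‖y‖ ^ α`. -/
def failProb (d : ℕ) (α : ℝ) (m : ℕ) (lam θ : ℝ) : ℝ≥0∞ :=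
  ((fadingLaw m).prod (interferenceLaw d α m lam)) {q | q.1 < θ * q.2}

lemma measurableSet_fail (θ : ℝ) : MeasurableSet {q : ℝ × ℝ | q.1 < θ * q.2} :=
  measurableSet_lt measurable_fst (measurable_snd.const_mul θ)

lemma failProb_eq_lintegral (d : ℕ) (α : ℝ) (m : ℕ) (lam θ : ℝ) :
    failProb d α m lam θ = ∫⁻ x, fadingLaw m (Iio (θ * x)) ∂(interferenceLaw d α m lam) := by
  rw [failProb, Measure.prod_apply_symm (measurableSet_fail θ)]
  rfl

lemma measurable_failProb {d : ℕ} {α : ℝ} {m : ℕ} {lam : ℝ} :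
    Measurable (failProb d α m lam) := by
  have hs : MeasurableSet {z : ℝ × (ℝ × ℝ) | z.2.1 < z.1 * z.2.2} :=
    measurableSet_lt (by fun_prop) (by fun_prop)
  exact measurable_measure_prodMk_left hs

lemma failProb_le_one {d : ℕ} {α : ℝ} {m : ℕ} (hm : 1 ≤ m) (lam θ : ℝ) :
    failProb d α m lam θ ≤ 1 := by
  have := isProbabilityMeasure_fadingLaw hm
  exact prob_le_one

lemma failProb_mono {d : ℕ} {α : ℝ} {m : ℕ} (lam : ℝ) {θ θ' : ℝ} (h : θ ≤ θ') :
    failProb d α m lam θ ≤ failProb d α m lam θ' := by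
  rw [failProb_eq_lintegral, failProb_eq_lintegral]
  refine lintegral_mono_ae ?_
  filter_upwards [ae_interferenceLaw_nonneg d α m lam] with x hx
  exact measure_mono (Iio_subset_Iio (by gcongr))

lemma continuous_failProb {d : ℕ} {α : ℝ} (hd : 1 ≤ d) (hα : (d : ℝ) < α) {m : ℕ} (hm : 1 ≤ m)
    {θ : ℝ} (hθ : 0 ≤ θ) : Continuous fun lam => failProb d α m lam θ := by
  have := isProbabilityMeasure_fadingLaw hm
  have hc : Continuous fun x : ℝ => (fadingLaw m).real (Iio (θ * x)) :=
    (continuous_fadingLaw_Iio hm).comp (continuous_const.mul continuous_id)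
  have h : ∀ lam, failProb d α m lam θ
      = ENNReal.ofReal (∫ x, (fadingLaw m).real (Iio (θ * x)) ∂(interferenceLaw d α m lam)) := by
    intro lam
    rw [failProb_eq_lintegral, ofReal_integral_eq_lintegral_ofReal]
    · simp_rw [measureReal_def, ENNReal.ofReal_toReal (measure_ne_top (fadingLaw m) _)]
    · refine Integrable.of_bound hc.aestronglyMeasurable 1 (ae_of_all _ fun x => ?_)
      rw [Real.norm_of_nonneg measureReal_nonneg]
      exact measureReal_le_one
    · exact ae_of_all _ fun x => measureReal_nonneg
  simp_rw [h]
  refine ENNReal.continuous_ofReal.comp ?_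
  -- At `θ = 0` the integrand does not tend to `1`, but it is constant in `x`.
  rcases hθ.eq_or_lt with rfl | hθ
  · simpa using continuous_const
  · exact continuous_integral_interferenceLaw hd hα hm hc (L := 1)
      ((tendsto_fadingLaw_Iio_atTop hm).comp (tendsto_id.const_mul_atTop hθ))

/-- Conditionally on `I`, failure has probability at most a constant times `1 - e^{-θI}`; averaging
leaves the Laplace transform bound. -/
lemma failProb_le {d : ℕ} {α : ℝ} (hd : 1 ≤ d) (hα : (d : ℝ) < α) {m : ℕ} (hm : 1 ≤ m) :
    ∃ C : ℝ, 0 < C ∧ ∀ lam θ : ℝ, 0 ≤ lam → 0 < θ →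
      failProb d α m lam θ ≤ ENNReal.ofReal (C * lam * θ ^ ((d : ℝ) / α)) := by
  obtain ⟨K, hK, hKt⟩ := lintegral_one_sub_exp_interferenceLaw_le hd hα hm
  have hC := fadingConst_pos hm
  refine ⟨fadingConst m * K, by positivity, fun lam θ hlam hθ => ?_⟩
  rw [failProb_eq_lintegral]
  calc _ ≤ ∫⁻ x, ENNReal.ofReal (fadingConst m) * ENNReal.ofReal (1 - Real.exp (-(θ * x)))
        ∂(interferenceLaw d α m lam) := by
        refine lintegral_mono_ae ?_
        filter_upwards [ae_interferenceLaw_nonneg d α m lam] with x hx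
        rw [← ENNReal.ofReal_mul hC.le]
        exact fadingLaw_Iio_le hm (by positivity)
    _ ≤ ENNReal.ofReal (fadingConst m) * ENNReal.ofReal (K * lam * θ ^ ((d : ℝ) / α)) := by
        rw [lintegral_const_mul _ (by fun_prop)]
        gcongr
        exact hKt lam θ hlam hθ
    _ = _ := by
        rw [← ENNReal.ofReal_mul hC.le]; congr 1; ring

/-- The attempt fails whenever `H < 1` and `I ≥ 1/θ`. These events are independent, and the second
is likely enough by `interferenceLaw_Iio_le`. -/
lemma le_failProb {d : ℕ} {α : ℝ} (hd : 1 ≤ d) (hα : (d : ℝ) < α) {m : ℕ} (hm : 1 ≤ m)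
    {lam q θ : ℝ} (hlam : 0 ≤ lam) (hq : 0 < q) (hθ : 0 < θ)
    (hqθ : 2 ≤ (q * θ) ^ ((d : ℝ) / α)) :
    ENNReal.ofReal ((fadingLaw m).real (Iio 1) * (1 - Real.exp (-(lam *
      (unitVolume d * (fadingLaw m).real (Ici q) / 2 * (q * θ) ^ ((d : ℝ) / α))))))
      ≤ failProb d α m lam θ := by
  have := isProbabilityMeasure_fadingLaw hm
  have hsub : Iio (1 : ℝ) ×ˢ Ici θ⁻¹ ⊆ {q : ℝ × ℝ | q.1 < θ * q.2} := by
    rintro ⟨h, x⟩ ⟨h1, h2⟩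
    simp only [mem_Iio, mem_Ici, mem_ofPred_eq] at h1 h2 ⊢
    exact h1.trans_le (by rwa [inv_le_iff_one_le_mul₀' hθ] at h2)
  refine le_trans ?_ (measure_mono hsub)
  rw [Measure.prod_prod, ← ofReal_measureReal, ← ofReal_measureReal,
    ← ENNReal.ofReal_mul measureReal_nonneg]
  refine ENNReal.ofReal_le_ofReal ?_
  gcongr
  have h := interferenceLaw_Iio_le hd hα hm hlam hq (inv_pos.2 hθ) (by rwa [div_inv_eq_mul])
  rw [div_inv_eq_mul] at h
  have h2 : (interferenceLaw d α m lam).real (Ici θ⁻¹)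
      = 1 - (interferenceLaw d α m lam).real (Iio θ⁻¹) := by
    rw [← compl_Iio, probReal_compl_eq_one_sub measurableSet_Iio]
  linarith

/-! ### The outage probability -/

/-- The mean number of receivers that are not connected. -/
def outageExponent (d : ℕ) (α : ℝ) (m : ℕ) (β : ℝ) (τ : ℕ) (s lamR lam : ℝ) : ℝ≥0∞ :=
  ENNReal.ofReal lamR * ∫⁻ y in cluster d s, failProb d α m lam (β * ‖y‖ ^ α) ^ τ

lemma clusterVolume_eq {d : ℕ} {s : ℝ} (hs : 0 ≤ s) : clusterVolume d s = s ^ d * unitVolume d := by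
  have := unitVolume_pos d
  rw [clusterVolume, cluster, volume_closedBall hs, ENNReal.toReal_ofReal (by positivity)]

lemma volume_cluster {d : ℕ} {s : ℝ} (hs : 0 ≤ s) :
    volume (cluster d s) = ENNReal.ofReal (s ^ d * unitVolume d) := volume_closedBall hs

/-- Being unconnected means failing in all attempts, which for fixed `y` is a product set in the
independent marks; hence the `τ`-th power. -/
lemma receiverIntensity_not_connected {d : ℕ} {α : ℝ} {m : ℕ} (hm : 1 ≤ m) (β : ℝ)
    (τ : ℕ) (s lamR lam : ℝ) :
    MeasurableSet {p : EuclideanSpace ℝ (Fin d) × (Fin τ → ℝ × ℝ) | ¬ Connected α β p} ∧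
    receiverIntensity d α m τ s lamR lam {p | ¬ Connected α β p}
      = outageExponent d α m β τ s lamR lam := by
  have := isProbabilityMeasure_fadingLaw hm
  have hset : {p : EuclideanSpace ℝ (Fin d) × (Fin τ → ℝ × ℝ) | ¬ Connected α β p}
      = ⋂ i, {p | (p.2 i).1 < β * ‖p.1‖ ^ α * (p.2 i).2} := by
    ext p; simp [Connected]
  have hmeas : MeasurableSet
      {p : EuclideanSpace ℝ (Fin d) × (Fin τ → ℝ × ℝ) | ¬ Connected α β p} := by
    rw [hset]
    exact MeasurableSet.iInter fun i => measurableSet_lt (by fun_prop) (by fun_prop)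
  refine ⟨hmeas, ?_⟩
  rw [receiverIntensity, Measure.prod_apply hmeas, lintegral_smul_measure, smul_eq_mul,
    outageExponent]
  congr 2
  ext y
  have hpre : Prod.mk y ⁻¹' {p : EuclideanSpace ℝ (Fin d) × (Fin τ → ℝ × ℝ) | ¬ Connected α β p}
      = univ.pi fun _ => {q : ℝ × ℝ | q.1 < β * ‖y‖ ^ α * q.2} := by
    ext z; simp [Connected]
  rw [hpre, Measure.pi_pi, Finset.prod_const, Finset.card_univ, Fintype.card_fin, failProb]

lemma outageExponent_ne_top {d : ℕ} {α : ℝ} {m : ℕ} (hm : 1 ≤ m) (β : ℝ) (τ : ℕ)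
    (s lamR lam : ℝ) : outageExponent d α m β τ s lamR lam ≠ ∞ := by
  refine ENNReal.mul_ne_top ENNReal.ofReal_ne_top (ne_top_of_le_ne_top
    (measure_closedBall_lt_top (μ := volume) (x := (0 : EuclideanSpace ℝ (Fin d))) (r := s)).ne ?_)
  calc _ ≤ ∫⁻ _ in cluster d s, 1 := lintegral_mono fun y => pow_le_one' (failProb_le_one hm _ _) _
    _ = _ := by rw [setLIntegral_one]; rfl

lemma outage_eq {d : ℕ} {α : ℝ} {m : ℕ} (hm : 1 ≤ m) (β : ℝ) (τ : ℕ) (s lamR lam : ℝ) :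
    outage d α m β τ s lamR lam
      = 1 - Real.exp (-(outageExponent d α m β τ s lamR lam).toReal) := by
  obtain ⟨h1, h2⟩ := receiverIntensity_not_connected (d := d) (α := α) hm β τ s lamR lam
  have hm0 : MeasurableSet {N : Measure (EuclideanSpace ℝ (Fin d) × (Fin τ → ℝ × ℝ)) |
      N {p | ¬ Connected α β p} = 0} :=
    Measure.measurable_coe h1 (measurableSet_singleton 0)
  have h3 := probReal_compl_eq_one_sub
    (μ := poissonProcess (receiverIntensity d α m τ s lamR lam)) hm0
  rw [measureReal_def _ {N | _ = _}, poissonProcess_void _ h1, h2,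
    negExp_of_ne_top (outageExponent_ne_top hm β τ s lamR lam),
    ENNReal.toReal_ofReal (Real.exp_pos _).le] at h3
  exact h3

/-- Makes the feasible set closed, so that its supremum is attained. -/
lemma continuous_outage {d : ℕ} {α : ℝ} (hd : 1 ≤ d) (hα : (d : ℝ) < α) {m : ℕ} (hm : 1 ≤ m)
    {β : ℝ} (hβ : 0 ≤ β) (τ : ℕ) (s lamR : ℝ) :
    Continuous fun lam => outage d α m β τ s lamR lam := by
  simp_rw [outage_eq hm]
  refine continuous_const.sub (Real.continuous_exp.comp (Continuous.neg ?_))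
  refine ENNReal.continuousOn_toReal.comp_continuous ?_
    fun lam => outageExponent_ne_top hm β τ s lamR lam
  refine (ENNReal.continuous_const_mul ENNReal.ofReal_ne_top).comp ?_
  refine continuous_iff_continuousAt.2 fun lam => ?_
  refine tendsto_lintegral_filter_of_dominated_convergence (fun _ => 1)
    (Eventually.of_forall fun l => ?_) (Eventually.of_forall fun l => ae_of_all _ fun y => ?_) ?_
    (ae_of_all _ fun y => ?_)
  · exact (measurable_failProb.comp (by fun_prop)).pow_const τ
  · exact pow_le_one' (failProb_le_one hm _ _) _
  · rw [setLIntegral_one]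
    exact (measure_closedBall_lt_top (x := (0 : EuclideanSpace ℝ (Fin d))) (r := s)).ne
  · exact ((ENNReal.continuous_pow τ).comp
      (continuous_failProb hd hα hm (by positivity))).tendsto lam

/-- Failure is most likely at the cluster edge, where `(β s^α)^{d/α}` is a multiple of `s^d`. The
constant stays inside the `τ`-th power, which is what later makes the bounds uniform in `τ`. -/
lemma outageExponent_le {d : ℕ} {α : ℝ} (hd : 1 ≤ d) (hα : (d : ℝ) < α) {m : ℕ} (hm : 1 ≤ m)
    {β : ℝ} (hβ : 0 < β) :
    ∃ C : ℝ, 0 < C ∧ ∀ (τ : ℕ) (s lamR lam : ℝ), 1 ≤ s → 0 < lamR → 0 ≤ lam →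
      (outageExponent d α m β τ s lamR lam).toReal
        ≤ meanReceivers d s lamR * (C * (lam * s ^ d)) ^ τ := by
  obtain ⟨C, hC, hCt⟩ := failProb_le hd hα hm
  have hα0 : 0 < α := lt_of_le_of_lt (by positivity) hα
  have hV := unitVolume_pos d
  refine ⟨C * β ^ ((d : ℝ) / α), by positivity, fun τ s lamR lam hs hR hlam => ?_⟩
  have hs0 : 0 < s := by linarith
  have hle : outageExponent d α m β τ s lamR lam ≤ ENNReal.ofReal lamR *
      (ENNReal.ofReal (C * lam * (β * s ^ α) ^ ((d : ℝ) / α)) ^ τ * volume (cluster d s)) := by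
    rw [outageExponent, ← setLIntegral_const]
    refine mul_le_mul_right ?_ _
    refine setLIntegral_mono measurable_const fun y hy => ?_
    gcongr
    refine (failProb_mono lam ?_).trans (hCt lam _ hlam (by positivity))
    have : ‖y‖ ≤ s := by simpa [cluster] using hy
    gcongr
  rw [volume_cluster hs0.le, ← ENNReal.ofReal_pow (by positivity),
    ← ENNReal.ofReal_mul (by positivity), ← ENNReal.ofReal_mul hR.le] at hle
  refine (ENNReal.toReal_le_of_le_ofReal (by positivity) hle).trans_eq ?_
  have h1 : (β * s ^ α) ^ ((d : ℝ) / α) = β ^ ((d : ℝ) / α) * s ^ d := by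
    rw [Real.mul_rpow hβ.le (by positivity), ← Real.rpow_mul hs0.le, mul_div_cancel₀ _ hα0.ne',
      Real.rpow_natCast]
  rw [h1, meanReceivers, clusterVolume_eq hs0.le]
  ring

/-- Only receivers in the outer shell `s/2 < |y| ≤ s` are counted: they make up at least half of the
cluster, and each fails at least as often as one at distance `s/2`. -/
lemma le_outageExponent {d : ℕ} {α : ℝ} (hd : 1 ≤ d) (hα : (d : ℝ) < α) {m : ℕ} (hm : 1 ≤ m)
    {β : ℝ} (hβ : 0 < β) :
    ∃ c c' : ℝ, 0 < c ∧ 0 < c' ∧ ∀ (τ : ℕ) (s lamR lam : ℝ), 1 ≤ s → 0 < lamR → 0 ≤ lam →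
      meanReceivers d s lamR / 2 * (c * (1 - Real.exp (-(c' * (lam * s ^ d))))) ^ τ
        ≤ (outageExponent d α m β τ s lamR lam).toReal := by
  have hα0 : 0 < α := lt_of_le_of_lt (by positivity) hα
  have hV := unitVolume_pos d
  -- Chosen so that `q β (s/2)^α = (2s)^α`; then the hypothesis of `le_failProb` reads `2 ≤ (2s)^d`,
  -- true since `s ≥ 1`.
  set q : ℝ := 4 ^ α / β with hq
  have hq0 : 0 < q := by positivity
  have hF := fadingLaw_Ici_pos hm hq0.le
  have hG := fadingLaw_Iio_pos hm one_pos
  refine ⟨(fadingLaw m).real (Iio 1), unitVolume d * (fadingLaw m).real (Ici q) / 2, hG,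
    by positivity, fun τ s lamR lam hs hR hlam => ?_⟩
  have hs0 : 0 < s := by linarith
  set A : ℝ := (fadingLaw m).real (Iio 1) * (1 - Real.exp (-(unitVolume d *
    (fadingLaw m).real (Ici q) / 2 * (lam * s ^ d)))) with hA
  have hA0 : 0 ≤ A := mul_nonneg hG.le (by
    rw [sub_nonneg, Real.exp_le_one_iff, neg_nonpos]; positivity)
  have hqs : (q * (β * (s / 2) ^ α)) ^ ((d : ℝ) / α) = (2 * s) ^ d := by
    have : q * (β * (s / 2) ^ α) = (2 * s) ^ α := by
      rw [hq, ← mul_assoc, div_mul_cancel₀ _ hβ.ne', ← Real.mul_rpow (by norm_num) (by positivity)]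
      congr 1; ring
    rw [this, ← Real.rpow_mul (by positivity), mul_div_cancel₀ _ hα0.ne', Real.rpow_natCast]
  have hpt : ∀ y ∈ Metric.closedBall (0 : EuclideanSpace ℝ (Fin d)) s \ Metric.closedBall 0 (s / 2),
      ENNReal.ofReal A ^ τ ≤ failProb d α m lam (β * ‖y‖ ^ α) ^ τ := by
    intro y hy
    gcongr
    have hy2 : s / 2 ≤ ‖y‖ := by
      have := hy.2
      simp only [Metric.mem_closedBall, dist_zero_right, not_le] at this
      exact this.le
    have h2 : (2 : ℝ) ≤ (2 * s) ^ d :=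
      (by linarith : (2 : ℝ) ≤ 2 * s).trans (le_self_pow₀ (by linarith) (by omega))
    refine le_trans ?_ ((le_failProb hd hα hm hlam hq0 (θ := β * (s / 2) ^ α) (by positivity)
      (by rwa [hqs])).trans (failProb_mono lam (by gcongr)))
    rw [hqs, hA]
    refine ENNReal.ofReal_le_ofReal (mul_le_mul_of_nonneg_left (sub_le_sub_left
      (Real.exp_le_exp.2 (neg_le_neg ?_)) _) hG.le)
    have h3 : s ^ d ≤ (2 * s) ^ d := by gcongr; linarith
    calc unitVolume d * (fadingLaw m).real (Ici q) / 2 * (lam * s ^ d)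
        = lam * (unitVolume d * (fadingLaw m).real (Ici q) / 2 * s ^ d) := by ring
      _ ≤ _ := by gcongr
  have hle : ENNReal.ofReal lamR * (ENNReal.ofReal A ^ τ *
      volume (Metric.closedBall (0 : EuclideanSpace ℝ (Fin d)) s \ Metric.closedBall 0 (s / 2)))
      ≤ outageExponent d α m β τ s lamR lam := by
    rw [outageExponent, ← setLIntegral_const]
    refine mul_le_mul_right ?_ _
    have hmeas : MeasurableSet (Metric.closedBall (0 : EuclideanSpace ℝ (Fin d)) s \
        Metric.closedBall 0 (s / 2)) :=
      Metric.isClosed_closedBall.measurableSet.diff Metric.isClosed_closedBall.measurableSet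
    exact (setLIntegral_mono' hmeas hpt).trans (lintegral_mono_set sdiff_subset)
  have hhalf : (s / 2) ^ d ≤ s ^ d / 2 := by
    rw [div_pow]
    gcongr
    exact le_self_pow₀ (by norm_num) (by omega)
  have hsd : 0 < s ^ d := by positivity
  rw [volume_annulus (by positivity) (by linarith), ← ENNReal.ofReal_pow hA0,
    ← ENNReal.ofReal_mul (by positivity), ← ENNReal.ofReal_mul hR.le] at hle
  have h := (ENNReal.ofReal_le_iff_le_toReal (outageExponent_ne_top hm β τ s lamR lam)).1 hle
  refine le_trans ?_ h
  rw [meanReceivers, clusterVolume_eq hs0.le]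
  calc s ^ d * unitVolume d * lamR / 2 * A ^ τ
      = lamR * (A ^ τ * (s ^ d / 2 * unitVolume d)) := by ring
    _ ≤ _ := by gcongr; linarith

/-! ### The maximum contention intensity -/

lemma meanReceivers_pos {d : ℕ} {s lamR : ℝ} (hs : 0 < s) (hR : 0 < lamR) :
    0 < meanReceivers d s lamR := by
  have := unitVolume_pos d
  rw [meanReceivers, clusterVolume_eq hs.le]; positivity

lemma isClosed_feasible {d : ℕ} {α : ℝ} (hd : 1 ≤ d) (hα : (d : ℝ) < α) {m : ℕ} (hm : 1 ≤ m)
    {β : ℝ} (hβ : 0 ≤ β) (τ : ℕ) (s lamR ε : ℝ) : IsClosed (feasible d α m β τ s lamR ε) :=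
  isClosed_Ici.inter (isClosed_le (continuous_outage hd hα hm hβ τ s lamR) continuous_const)

lemma outage_le_iff {d : ℕ} {α : ℝ} {m : ℕ} (hm : 1 ≤ m) (β : ℝ) (τ : ℕ) (s lamR lam : ℝ)
    {ε : ℝ} (hε : ε < 1) :
    outage d α m β τ s lamR lam ≤ ε
      ↔ (outageExponent d α m β τ s lamR lam).toReal ≤ -Real.log (1 - ε) := by
  rw [outage_eq hm, sub_le_comm, ← Real.log_le_iff_le_exp (by linarith), le_neg]

/-- Undoes the saturation `1 - e^{-u}` of the lower bound: `e^{-u} ≤ 1/(1+u)` gives `u ≤ v/(1-v)`,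
and `v ≤ 1/2`. -/
lemma le_two_mul_of_one_sub_exp_neg_le {u v : ℝ} (hu : 0 ≤ u) (hv : v ≤ 1 / 2)
    (h : 1 - Real.exp (-u) ≤ v) : u ≤ 2 * v := by
  have h1 : Real.exp (-u) ≤ 1 / (1 + u) := by
    rw [Real.exp_neg, ← one_div]
    exact one_div_le_one_div_of_le (by linarith) (by linarith [Real.add_one_le_exp u])
  have h2 : 1 - v ≤ 1 / (1 + u) := by linarith
  rw [le_div_iff₀ (by linarith)] at h2
  nlinarith

/-- Feasibility is `Λ ≤ -log (1 - ε)`, and the right side lies between `ε` and `ε/(1 - ε₀)`. The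
lower bound on `Λ` caps every feasible intensity; the upper bound exhibits a feasible one. -/
theorem maxIntensity_bounds {d : ℕ} {α : ℝ} (hd : 1 ≤ d) (hα : (d : ℝ) < α) {m : ℕ} (hm : 1 ≤ m)
    {β : ℝ} (hβ : 0 < β) {ε₀ : ℝ} (hε₀ : ε₀ < 1) :
    ∃ c C : ℝ, 0 < c ∧ 0 < C ∧ ∀ τ : ℕ, 1 ≤ τ → ∀ ε : ℝ, 0 < ε → ε ≤ ε₀ →
      ∃ k₀ : ℝ, ∀ s lamR : ℝ, 1 ≤ s → 0 < lamR → k₀ ≤ meanReceivers d s lamR →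
        IsGreatest (feasible d α m β τ s lamR ε) (maxIntensity d α m β τ s lamR ε) ∧
        Between c C ((ε / meanReceivers d s lamR) ^ (1 / (τ : ℝ)))
          (maxIntensity d α m β τ s lamR ε * s ^ d) := by
  obtain ⟨C₁, hC₁, hup⟩ := outageExponent_le hd hα hm hβ
  obtain ⟨c₁, c₂, hc₁, hc₂, hlow⟩ := le_outageExponent hd hα hm hβ
  -- As `B ≥ 1`, the factor `2/(1 - ε₀)` is at most `B^τ`, so it survives the `τ`-th root as a
  -- constant free of `τ`.
  set B : ℝ := max 1 (2 / (1 - ε₀)) with hB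
  have hB1 : 1 ≤ B := le_max_left _ _
  have hε₀1 : 0 < 1 - ε₀ := by linarith
  -- The threshold `(2B/c₁)^τ` forces `B x / c₁ ≤ 1/2`, the range in which the saturation can be
  -- inverted.
  refine ⟨1 / C₁, 2 * B / (c₁ * c₂), by positivity, by positivity, fun τ hτ ε hε hεε₀ =>
    ⟨(2 * B / c₁) ^ τ, fun s lamR hs hR hk => ?_⟩⟩
  set k := meanReceivers d s lamR with hkdef
  have hk0 : 0 < k := meanReceivers_pos (by linarith) hR
  have hs0 : 0 < s := by linarith
  have hτ0 : τ ≠ 0 := by omega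
  set x := (ε / k) ^ (1 / (τ : ℝ)) with hx
  have hx0 : 0 < x := by positivity
  have hxτ : x ^ τ = ε / k := by
    rw [hx, one_div, Real.rpow_inv_natCast_pow (by positivity) hτ0]
  have hε1 : ε < 1 := by linarith
  have hxsmall : B * x / c₁ ≤ 1 / 2 := by
    have h1 : (2 * B / c₁ * x) ^ τ ≤ 1 := by
      rw [mul_pow, hxτ]
      calc (2 * B / c₁) ^ τ * (ε / k) ≤ k * (1 / k) := by gcongr
        _ = 1 := by field_simp
    have h2 : 2 * B / c₁ * x ≤ 1 := by
      by_contra! h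
      exact absurd h1 (not_le.2 (one_lt_pow₀ h hτ0))
    have h3 : 2 * B / c₁ * x = 2 * (B * x / c₁) := by ring
    linarith
  have hfeas_up : ∀ lam ∈ feasible d α m β τ s lamR ε, lam * s ^ d ≤ 2 * B / (c₁ * c₂) * x := by
    rintro lam ⟨hlam, hout⟩
    rw [outage_le_iff hm β τ s lamR lam hε1] at hout
    have hlog : -Real.log (1 - ε) ≤ ε / (1 - ε₀) := by
      have h1 := Real.one_sub_inv_le_log_of_pos (show 0 < 1 - ε by linarith)
      have h2 : (1 - ε)⁻¹ - 1 = ε / (1 - ε) := by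
        field_simp [show 1 - ε ≠ 0 by linarith]; ring
      have h3 : ε / (1 - ε) ≤ ε / (1 - ε₀) := by gcongr
      linarith
    set e := 1 - Real.exp (-(c₂ * (lam * s ^ d))) with he
    have hu0 : 0 ≤ c₂ * (lam * s ^ d) := by positivity
    have he0 : 0 ≤ e := by rw [he, sub_nonneg, Real.exp_le_one_iff]; linarith
    have h1 := (hlow τ s lamR lam hs hR hlam).trans (hout.trans hlog)
    have h2 : (c₁ * e) ^ τ ≤ (B * x) ^ τ := by
      rw [mul_pow B, hxτ]
      have h3 : k * (c₁ * e) ^ τ ≤ 2 / (1 - ε₀) * ε := by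
        have h4 : k / 2 * (c₁ * e) ^ τ ≤ ε / (1 - ε₀) := h1
        calc k * (c₁ * e) ^ τ = 2 * (k / 2 * (c₁ * e) ^ τ) := by ring
          _ ≤ 2 * (ε / (1 - ε₀)) := by gcongr
          _ = _ := by ring
      have h5 : 2 / (1 - ε₀) ≤ B ^ τ := (le_max_right _ _).trans (le_self_pow₀ hB1 hτ0)
      rw [mul_div_assoc', le_div_iff₀ hk0, mul_comm _ k]
      exact h3.trans (by gcongr)
    have h6 : c₁ * e ≤ B * x := le_of_pow_le_pow_left₀ hτ0 (by positivity) h2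
    have h7 : e ≤ B * x / c₁ := by rwa [le_div_iff₀ hc₁, mul_comm]
    have h8 := le_two_mul_of_one_sub_exp_neg_le hu0 hxsmall h7
    rw [div_mul_eq_mul_div, le_div_iff₀ (by positivity)]
    have h9 : 2 * (B * x / c₁) = 2 * B * x / c₁ := by ring
    rw [h9, le_div_iff₀ hc₁] at h8
    linarith
  have hbdd : BddAbove (feasible d α m β τ s lamR ε) :=
    ⟨2 * B / (c₁ * c₂) * x / s ^ d, fun lam hlam => by
      rw [le_div_iff₀ (by positivity)]; exact hfeas_up lam hlam⟩
  -- At this intensity the upper bound on `Λ` equals `k x^τ = ε`, and `ε ≤ -log (1 - ε)`.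
  have hmem : x / (C₁ * s ^ d) ∈ feasible d α m β τ s lamR ε := by
    refine ⟨by positivity, ?_⟩
    rw [outage_le_iff hm β τ s lamR _ hε1]
    refine (hup τ s lamR _ hs hR (by positivity)).trans ?_
    have h1 : C₁ * (x / (C₁ * s ^ d) * s ^ d) = x := by field_simp
    rw [h1, hxτ, ← hkdef, mul_div_cancel₀ _ hk0.ne']
    have := Real.log_le_sub_one_of_pos (show 0 < 1 - ε by linarith)
    linarith
  have hgreatest : IsGreatest (feasible d α m β τ s lamR ε) (maxIntensity d α m β τ s lamR ε) :=
    ⟨(isClosed_feasible hd hα hm hβ.le τ s lamR ε).csSup_mem ⟨_, hmem⟩ hbdd,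
      fun lam hlam => le_csSup hbdd hlam⟩
  refine ⟨hgreatest, ?_, hfeas_up _ hgreatest.1⟩
  have h := hgreatest.2 hmem
  rw [div_le_iff₀ (by positivity)] at h
  rw [one_div_mul_eq_div, div_le_iff₀ hC₁]
  linarith

/-! ### The ergodic rate at the cluster edge -/

/-- On its natural scale `lam^{α/d}` the interference has a stretched-exponential lower tail,
uniformly in `lam ≤ 1`. Small `lam` ensures that the truncation radius is negligible. -/
lemma interferenceLaw_Iio_div_le {d : ℕ} {α : ℝ} (hd : 1 ≤ d) (hα : (d : ℝ) < α) {m : ℕ}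
    (hm : 1 ≤ m) :
    ∃ c : ℝ, 0 < c ∧ ∀ lam t : ℝ, 0 < lam → lam ≤ 1 → 0 < t → 2 ≤ t ^ ((d : ℝ) / α) →
      (interferenceLaw d α m lam).real (Iio (lam ^ (α / d) / t))
        ≤ Real.exp (-c * t ^ ((d : ℝ) / α)) := by
  have hα0 : 0 < α := lt_of_le_of_lt (by positivity) hα
  have hd0 : (0 : ℝ) < d := by positivity
  have hF := fadingLaw_Ici_pos hm zero_le_one
  have hV := unitVolume_pos d
  refine ⟨unitVolume d * (fadingLaw m).real (Ici 1) / 2, by positivity,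
    fun lam t hlam hlam1 ht h2 => ?_⟩
  have h1 : (1 / (lam ^ (α / d) / t)) ^ ((d : ℝ) / α) = t ^ ((d : ℝ) / α) / lam := by
    rw [one_div_div, Real.div_rpow ht.le (by positivity), ← Real.rpow_mul hlam.le,
      div_mul_div_cancel₀ hd0.ne', div_self hα0.ne', Real.rpow_one]
  have h := interferenceLaw_Iio_le hd hα hm hlam.le one_pos (a := lam ^ (α / d) / t)
    (by positivity) (by
      rw [h1, le_div_iff₀ hlam]
      nlinarith)
  refine h.trans_eq ?_
  rw [h1]
  congr 1
  field_simp

/-- Layer-cake formula: levels below `T` contribute at most `T`, higher ones are controlled by the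
integrable lower tail of the interference. -/
lemma lintegral_inv_interferenceLaw_le {d : ℕ} {α : ℝ} (hd : 1 ≤ d) (hα : (d : ℝ) < α) {m : ℕ}
    (hm : 1 ≤ m) :
    ∃ C : ℝ, 0 < C ∧ ∀ lam : ℝ, 0 < lam → lam ≤ 1 →
      ∫⁻ x, ENNReal.ofReal (lam ^ (α / d) / x) ∂(interferenceLaw d α m lam)
        ≤ ENNReal.ofReal C := by
  have hα0 : 0 < α := lt_of_le_of_lt (by positivity) hα
  have hd0 : (0 : ℝ) < d := by positivity
  obtain ⟨c, hc, hct⟩ := interferenceLaw_Iio_div_le hd hα hm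
  set T : ℝ := 2 ^ (α / d) with hT
  have hT0 : 0 < T := by positivity
  have hval := integral_exp_neg_mul_rpow (p := (d : ℝ) / α) (b := c) (by positivity) hc
  set G : ℝ := ∫ t in Ioi (0 : ℝ), Real.exp (-c * t ^ ((d : ℝ) / α)) with hG
  have hG0 : 0 < G := by
    rw [hval]
    have := Real.Gamma_pos_of_pos (s := 1 / ((d : ℝ) / α) + 1) (by positivity)
    positivity
  -- A non-integrable function has integral `0` by convention, so the positive closed form implies
  -- integrability.
  have hint : IntegrableOn (fun t => Real.exp (-c * t ^ ((d : ℝ) / α))) (Ioi 0) := by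
    by_contra h
    exact hG0.ne' (integral_undef h)
  refine ⟨T + G, by positivity, fun lam hlam hlam1 => ?_⟩
  rw [lintegral_eq_lintegral_meas_lt]
  · calc ∫⁻ t in Ioi 0, interferenceLaw d α m lam {x | t < lam ^ (α / d) / x}
        ≤ ∫⁻ t in Ioi (0 : ℝ), ((Iio T).indicator 1 t +
            ENNReal.ofReal (Real.exp (-c * t ^ ((d : ℝ) / α)))) := by
          refine setLIntegral_mono' measurableSet_Ioi fun t ht => ?_
          have ht : 0 < t := ht
          by_cases htT : t < T
          · rw [indicator_of_mem (mem_Iio.2 htT)]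
            exact prob_le_one.trans le_self_add
          · rw [indicator_of_notMem (by simpa using htT), zero_add]
            have h2 : 2 ≤ t ^ ((d : ℝ) / α) := by
              calc (2 : ℝ) = T ^ ((d : ℝ) / α) := by
                    rw [hT, ← Real.rpow_mul (by norm_num), div_mul_div_cancel₀ hd0.ne',
                      div_self hα0.ne', Real.rpow_one]
                _ ≤ _ := by gcongr; exact not_lt.1 htT
            refine le_trans (measure_mono ?_) ((ENNReal.le_ofReal_iff_toReal_le (measure_ne_top _ _)
              (Real.exp_pos _).le).2 (hct lam t hlam hlam1 ht h2))
            intro x (hx : t < lam ^ (α / d) / x)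
            have hx0 : 0 < x := by
              by_contra! h
              have : lam ^ (α / d) / x ≤ 0 := div_nonpos_of_nonneg_of_nonpos (by positivity) h
              linarith
            rw [mem_Iio, lt_div_iff₀ ht]
            rw [lt_div_iff₀ hx0] at hx
            linarith
      _ = (∫⁻ t in Ioi (0 : ℝ), (Iio T).indicator 1 t) +
            ∫⁻ t in Ioi (0 : ℝ), ENNReal.ofReal (Real.exp (-c * t ^ ((d : ℝ) / α))) :=
          lintegral_add_left (measurable_one.indicator measurableSet_Iio) _
      _ = ENNReal.ofReal T + ENNReal.ofReal G := by
          rw [lintegral_indicator_one measurableSet_Iio, Measure.restrict_apply measurableSet_Iio,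
            hG, ofReal_integral_eq_lintegral_ofReal hint (ae_of_all _ fun t => (Real.exp_pos _).le),
            inter_comm, Ioi_inter_Iio, Real.volume_Ioo, sub_zero]
      _ = _ := by rw [ENNReal.ofReal_add hT0.le hG0.le]
  · filter_upwards [ae_interferenceLaw_nonneg d α m lam] with x hx
    simp only [Pi.zero_apply]
    positivity
  · fun_prop

lemma measurable_edgeRate (α : ℝ) {τ : ℕ} (s : ℝ) : Measurable (edgeRate α (τ := τ) s) := by
  have : Measurable fun p : (Fin τ → ℝ) × ℝ => ⨆ i, p.1 i :=
    Measurable.iSup fun i => by fun_prop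
  unfold edgeRate
  exact Real.measurable_log.comp (((this.mul_const _).div measurable_snd).const_add 1)

lemma ae_edgeLaw_nonneg {m : ℕ} (hm : 1 ≤ m) (d : ℕ) (α : ℝ) (τ : ℕ) (lam : ℝ) :
    ∀ᵐ p ∂(edgeLaw d α m τ lam), (∀ i, 0 ≤ p.1 i) ∧ 0 ≤ p.2 := by
  have := isProbabilityMeasure_fadingLaw hm
  have h1 : ∀ᵐ p ∂(edgeLaw d α m τ lam), ∀ i, 0 ≤ p.1 i := ae_all_iff.2 fun i =>
    ((measurePreserving_eval (fun _ : Fin τ => fadingLaw m) i).comp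
      measurePreserving_fst).quasiMeasurePreserving.ae (ae_fadingLaw_nonneg m)
  have h2 : ∀ᵐ p ∂(edgeLaw d α m τ lam), 0 ≤ p.2 :=
    measurePreserving_snd.quasiMeasurePreserving.ae (ae_interferenceLaw_nonneg d α m lam)
  filter_upwards [h1, h2] with p hp1 hp2 using ⟨hp1, hp2⟩

lemma ae_edgeRate_nonneg {m : ℕ} (hm : 1 ≤ m) (d : ℕ) (α : ℝ) (τ : ℕ) {s : ℝ} (hs : 0 ≤ s)
    (lam : ℝ) : ∀ᵐ p ∂(edgeLaw d α m τ lam), 0 ≤ edgeRate α s p := by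
  filter_upwards [ae_edgeLaw_nonneg hm d α τ lam] with p ⟨h1, h2⟩
  have h3 : 0 ≤ ⨆ i, p.1 i := Real.iSup_nonneg h1
  exact Real.log_nonneg (by linarith [show 0 ≤ (⨆ i, p.1 i) * s ^ (-α) / p.2 by positivity])

/-- Separates the deterministic part of the edge path loss, a power of the load, from the scale of
the interference. -/
lemma rpow_neg_pathLoss_eq {d : ℕ} {α : ℝ} (hd : 1 ≤ d) {s lam : ℝ} (hs : 0 < s) (hlam : 0 < lam) :
    s ^ (-α) = (lam * s ^ d) ^ (-(α / d)) * lam ^ (α / d) := by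
  have hd0 : (d : ℝ) ≠ 0 := by positivity
  rw [Real.mul_rpow hlam.le (by positivity), ← Real.rpow_natCast s d, ← Real.rpow_mul hs.le,
    mul_neg, mul_div_cancel₀ _ hd0, Real.rpow_neg hlam.le, mul_right_comm,
    inv_mul_cancel₀ (by positivity), one_mul]

/-- With `h` the largest gain, `u = δ^{-α/d}` and `v = λ^{α/d}/I`, the bound `1 + huv ≤
(1+h)(1+u)(1+v)` splits the logarithm. Then `log (1+h)` is at most the sum of the gains and `log
(1+v) ≤ v` has bounded mean. The crude term linear in `τ` is harmless, as `log k / τ` eventually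
exceeds it. -/
theorem multicastRate_le {d : ℕ} {α : ℝ} (hd : 1 ≤ d) (hα : (d : ℝ) < α) {m : ℕ} (hm : 1 ≤ m) :
    ∃ C : ℝ, 0 < C ∧ ∀ (τ : ℕ) (s lam : ℝ), 1 ≤ s → 0 < lam → lam * s ^ d ≤ 1 →
      Integrable (edgeRate α s) (edgeLaw d α m τ lam) ∧
      multicastRate d α m τ s lam
        ≤ τ * fadingMean m + Real.log (1 + (lam * s ^ d) ^ (-(α / d))) + C := by
  obtain ⟨C, hC, hCt⟩ := lintegral_inv_interferenceLaw_le hd hα hm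
  have := isProbabilityMeasure_fadingLaw hm
  refine ⟨C, hC, fun τ s lam hs hlam hδ => ?_⟩
  have hs0 : 0 < s := by linarith
  have hlam1 : lam ≤ 1 := by
    have := one_le_pow₀ hs (n := d)
    nlinarith
  set δ := lam * s ^ d with hδdef
  have hδ0 : 0 < δ := by positivity
  have hl0 : 0 ≤ Real.log (1 + δ ^ (-(α / d))) :=
    Real.log_nonneg (by linarith [show 0 ≤ δ ^ (-(α / d)) by positivity])
  have hM0 : 0 ≤ fadingMean m := ENNReal.toReal_nonneg
  have hpt : ∀ᵐ p ∂(edgeLaw d α m τ lam), ENNReal.ofReal (edgeRate α s p)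
      ≤ (∑ i, ENNReal.ofReal (p.1 i) + ENNReal.ofReal (Real.log (1 + δ ^ (-(α / d)))))
        + ENNReal.ofReal (lam ^ (α / d) / p.2) := by
    filter_upwards [ae_edgeLaw_nonneg hm d α τ lam] with p ⟨h1, h2⟩
    rw [← ENNReal.ofReal_sum_of_nonneg fun i _ => h1 i,
      ← ENNReal.ofReal_add (Finset.sum_nonneg fun i _ => h1 i) hl0,
      ← ENNReal.ofReal_add (add_nonneg (Finset.sum_nonneg fun i _ => h1 i) hl0) (by positivity)]
    refine ENNReal.ofReal_le_ofReal ?_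
    have hsup0 : 0 ≤ ⨆ i, p.1 i := Real.iSup_nonneg h1
    have hsup : ⨆ i, p.1 i ≤ ∑ i, p.1 i := Real.iSup_le
      (fun i => Finset.single_le_sum (fun j _ => h1 j) (Finset.mem_univ i))
      (Finset.sum_nonneg fun i _ => h1 i)
    set h := ⨆ i, p.1 i
    set u := δ ^ (-(α / d)) with hu
    set v := lam ^ (α / d) / p.2 with hv
    have hu0 : 0 < u := by positivity
    have hv0 : 0 ≤ v := by positivity
    have hprod : 1 + h * s ^ (-α) / p.2 ≤ (1 + h) * ((1 + u) * (1 + v)) := by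
      rw [rpow_neg_pathLoss_eq hd hs0 hlam, ← hδdef, ← hu]
      have : h * (u * lam ^ (α / d)) / p.2 = h * (u * v) := by rw [hv]; ring
      rw [this]
      have h3 : 0 ≤ u * v := by positivity
      nlinarith [mul_nonneg hsup0 hu0.le, mul_nonneg hsup0 hv0]
    calc edgeRate α s p ≤ Real.log ((1 + h) * ((1 + u) * (1 + v))) :=
          Real.log_le_log (by positivity) hprod
      _ = Real.log (1 + h) + (Real.log (1 + u) + Real.log (1 + v)) := by
          rw [Real.log_mul (by positivity) (by positivity),
            Real.log_mul (by positivity) (by positivity)]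
      _ ≤ _ := by
          have h4 := Real.log_le_sub_one_of_pos (show 0 < 1 + h by positivity)
          have h5 := Real.log_le_sub_one_of_pos (show 0 < 1 + v by positivity)
          linarith
  have hlin : ∫⁻ p, ENNReal.ofReal (edgeRate α s p) ∂(edgeLaw d α m τ lam)
      ≤ ENNReal.ofReal (τ * fadingMean m + Real.log (1 + δ ^ (-(α / d))) + C) := by
    refine (lintegral_mono_ae hpt).trans ?_
    rw [lintegral_add_right _ (by fun_prop), lintegral_add_right _ measurable_const,
      lintegral_finsetSum _ (fun i _ => by fun_prop), lintegral_const, edgeLaw, measure_univ,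
      mul_one, ENNReal.ofReal_add (by positivity) hC.le, ENNReal.ofReal_add (by positivity) hl0]
    gcongr
    · have h1 : ∀ i : Fin τ, ∫⁻ p, ENNReal.ofReal (p.1 i)
          ∂((Measure.pi fun _ : Fin τ => fadingLaw m).prod (interferenceLaw d α m lam))
          = ENNReal.ofReal (fadingMean m) := fun i => by
        rw [ofReal_fadingMean hm]
        exact ((measurePreserving_eval (fun _ : Fin τ => fadingLaw m) i).comp
          measurePreserving_fst).lintegral_comp ENNReal.measurable_ofReal
      simp_rw [h1]
      rw [Finset.sum_const, Finset.card_univ, Fintype.card_fin, nsmul_eq_mul,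
        ENNReal.ofReal_mul (by positivity), ENNReal.ofReal_natCast]
    · refine le_trans (le_of_eq ?_) (hCt lam hlam hlam1)
      exact measurePreserving_snd.lintegral_comp
        (f := fun x => ENNReal.ofReal (lam ^ (α / d) / x)) (by fun_prop)
  have hnn := ae_edgeRate_nonneg hm d α τ hs0.le lam
  have hmeas := (measurable_edgeRate α (τ := τ) s).aestronglyMeasurable
    (μ := edgeLaw d α m τ lam)
  refine ⟨⟨hmeas, ?_⟩, ?_⟩
  · rw [hasFiniteIntegral_iff_ofReal hnn]
    exact hlin.trans_lt ENNReal.ofReal_lt_top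
  · rw [multicastRate, integral_eq_lintegral_of_nonneg_ae hnn hmeas]
    exact ENNReal.toReal_le_of_le_ofReal (by positivity) hlin

/-- It suffices to keep the event that one gain is at least `1` and the interference is of its
typical size; its probability is bounded below independently of `τ`, `s` and `lam`. -/
theorem le_multicastRate {d : ℕ} {α : ℝ} (hd : 1 ≤ d) (hα : (d : ℝ) < α) {m : ℕ} (hm : 1 ≤ m) :
    ∃ c K : ℝ, 0 < c ∧ 0 < K ∧ ∀ (τ : ℕ) (s lam : ℝ), 1 ≤ τ → 1 ≤ s → 0 < lam →
      lam * s ^ d ≤ 1 →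
      c * Real.log (1 + K * (lam * s ^ d) ^ (-(α / d))) ≤ multicastRate d α m τ s lam := by
  have hα0 : 0 < α := lt_of_le_of_lt (by positivity) hα
  have hd0 : (0 : ℝ) < d := by positivity
  have := isProbabilityMeasure_fadingLaw hm
  obtain ⟨_, _, hup⟩ := multicastRate_le hd hα hm
  obtain ⟨K₀, hK₀, hKt⟩ := interferenceLaw_Ici_le hd hα hm
  obtain ⟨c₀, hc₀, hct⟩ := interferenceLaw_Iio_div_le hd hα hm
  have hF := fadingLaw_Ici_pos hm zero_le_one
  have hinv : ∀ x : ℝ, 0 < x → (x ^ (α / d)) ^ ((d : ℝ) / α) = x := fun x hx => by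
    rw [← Real.rpow_mul hx.le, div_mul_div_cancel₀ hd0.ne', div_self hα0.ne', Real.rpow_one]
  set K : ℝ := (4 * K₀) ^ (α / d) with hK
  have hK0 : 0 < K := by positivity
  -- `K` and `t` make each tail of the interference at most `1/4`. The lower cutoff serves to keep
  -- `I` positive: at `I = 0` division by zero would make the rate `0`.
  set t : ℝ := (2 + 3 / c₀) ^ (α / d) with ht
  have ht0 : 0 < t := by positivity
  have htd : t ^ ((d : ℝ) / α) = 2 + 3 / c₀ := hinv _ (by positivity)
  refine ⟨(fadingLaw m).real (Ici 1) / 2, K⁻¹, by positivity, by positivity,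
    fun τ s lam hτ hs hlam hδ => ?_⟩
  have hs0 : 0 < s := by linarith
  have hlam1 : lam ≤ 1 := by
    have := one_le_pow₀ hs (n := d)
    nlinarith
  set δ := lam * s ^ d with hδdef
  have hδ0 : 0 < δ := by positivity
  set l := lam ^ (α / d) with hl
  have hl0 : 0 < l := by positivity
  have hbig : (interferenceLaw d α m lam).real (Ici (K * l)) ≤ 1 / 4 := by
    refine (hKt lam (K * l) hlam.le (by positivity)).trans_eq ?_
    rw [Real.rpow_neg (by positivity), Real.mul_rpow hK0.le hl0.le, hK, hl, hinv _ (by positivity),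
      hinv _ hlam]
    field_simp
  have hsmall : (interferenceLaw d α m lam).real (Iio (l / t)) ≤ 1 / 4 := by
    refine (hct lam t hlam hlam1 ht0 (by rw [htd]; linarith [show 0 < 3 / c₀ by positivity])).trans ?_
    have h1 : 3 ≤ c₀ * (2 + 3 / c₀) := by
      rw [mul_add, mul_div_cancel₀ _ hc₀.ne']; linarith
    rw [htd, neg_mul, Real.exp_neg, one_div]
    refine inv_anti₀ (by norm_num) ?_
    linarith [Real.add_one_le_exp (c₀ * (2 + 3 / c₀))]
  have hmid : 1 / 2 ≤ (interferenceLaw d α m lam).real (Ico (l / t) (K * l)) := by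
    have h1 : (univ : Set ℝ) ⊆ Iio (l / t) ∪ (Ico (l / t) (K * l) ∪ Ici (K * l)) := by
      intro x _
      rcases lt_or_ge x (l / t) with h | h
      · exact Or.inl h
      rcases lt_or_ge x (K * l) with h' | h'
      · exact Or.inr (Or.inl ⟨h, h'⟩)
      · exact Or.inr (Or.inr h')
    have h2 := (measureReal_mono (μ := interferenceLaw d α m lam) h1).trans
      ((measureReal_union_le _ _).trans (add_le_add le_rfl (measureReal_union_le _ _)))
    rw [probReal_univ] at h2
    linarith
  let i₀ : Fin τ := ⟨0, hτ⟩
  set A : Set ((Fin τ → ℝ) × ℝ) := (Function.eval i₀ ⁻¹' Ici 1) ×ˢ Ico (l / t) (K * l) with hA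
  have hAm : MeasurableSet A := (measurable_pi_apply i₀ measurableSet_Ici).prod measurableSet_Ico
  have hAreal : (fadingLaw m).real (Ici 1) / 2 ≤ (edgeLaw d α m τ lam).real A := by
    have h1 : (Measure.pi fun _ : Fin τ => fadingLaw m).real (Function.eval i₀ ⁻¹' Ici 1)
        = (fadingLaw m).real (Ici 1) :=
      (measurePreserving_eval (fun _ : Fin τ => fadingLaw m) i₀).measureReal_preimage
        measurableSet_Ici.nullMeasurableSet
    rw [edgeLaw, hA, measureReal_prod_prod, h1]
    nlinarith
  have hint := (hup τ s lam hs hlam hδ).1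
  set L := Real.log (1 + K⁻¹ * δ ^ (-(α / d))) with hL
  have hL0 : 0 ≤ L :=
    Real.log_nonneg (by linarith [show 0 ≤ K⁻¹ * δ ^ (-(α / d)) by positivity])
  have hprob : IsProbabilityMeasure (edgeLaw d α m τ lam) := by unfold edgeLaw; infer_instance
  calc (fadingLaw m).real (Ici 1) / 2 * L ≤ (edgeLaw d α m τ lam).real A * L := by gcongr
    _ = ∫ p, A.indicator (fun _ => L) p ∂(edgeLaw d α m τ lam) := by
        rw [integral_indicator_const _ hAm, smul_eq_mul]
    _ ≤ multicastRate d α m τ s lam := by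
        refine integral_mono_ae ((integrable_const L).indicator hAm) hint ?_
        filter_upwards [ae_edgeRate_nonneg hm d α τ hs0.le lam] with p hp
        by_cases hpA : p ∈ A
        · rw [indicator_of_mem hpA]
          obtain ⟨h1, h2, h3⟩ := hpA
          have h1 : 1 ≤ p.1 i₀ := h1
          have hp2 : 0 < p.2 := lt_of_lt_of_le (by positivity) h2
          have hsup : 1 ≤ ⨆ i, p.1 i :=
            h1.trans (le_ciSup (f := fun i => p.1 i) (finite_range _).bddAbove i₀)
          refine Real.log_le_log (by positivity) ?_
          rw [rpow_neg_pathLoss_eq hd hs0 hlam, ← hδdef, ← hl]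
          have h4 : K⁻¹ * δ ^ (-(α / d)) = 1 * (δ ^ (-(α / d)) * l) / (K * l) := by field_simp
          rw [h4]
          gcongr
        · rw [indicator_of_notMem hpA]
          exact hp

/-! ### Scaling of rate and capacity -/

/-- Here `log δ = (log ε - log k)/τ` up to a constant, so both rate bounds are multiples of `γ log k
/ τ` plus terms not involving `k`, which a large `k` absorbs. -/
theorem network_bounds {d : ℕ} {α : ℝ} (hd : 1 ≤ d) (hα : (d : ℝ) < α) {m : ℕ} (hm : 1 ≤ m)
    {β : ℝ} (hβ : 0 < β) {ε₀ : ℝ} (hε₀ : ε₀ < 1) :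
    ∃ c C c' C' : ℝ, 0 < c ∧ 0 < C ∧ 0 < c' ∧ 0 < C' ∧
      ∀ τ : ℕ, 1 ≤ τ → ∀ ε : ℝ, 0 < ε → ε ≤ ε₀ →
      ∃ k₀ : ℝ, ∀ s lamR : ℝ, 1 ≤ s → 0 < lamR → k₀ ≤ meanReceivers d s lamR →
        1 ≤ meanReceivers d s lamR ∧
        IsGreatest (feasible d α m β τ s lamR ε) (maxIntensity d α m β τ s lamR ε) ∧
        Integrable (edgeRate α s) (edgeLaw d α m τ (maxIntensity d α m β τ s lamR ε)) ∧
        Between c C (Real.log (meanReceivers d s lamR) / τ)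
          (multicastRate d α m τ s (maxIntensity d α m β τ s lamR ε)) ∧
        Between c' C' ((ε / meanReceivers d s lamR) ^ (1 / (τ : ℝ)))
          (maxIntensity d α m β τ s lamR ε * s ^ d) := by
  have hα0 : 0 < α := lt_of_le_of_lt (by positivity) hα
  have hd0 : (0 : ℝ) < d := by positivity
  obtain ⟨c₁, C₁, hc₁, hC₁, hmax⟩ := maxIntensity_bounds hd hα hm hβ hε₀
  obtain ⟨C₂, hC₂, hup⟩ := multicastRate_le hd hα hm
  obtain ⟨c₃, K, hc₃, hK, hlow⟩ := le_multicastRate hd hα hm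
  set γ := α / d with hγ
  have hγ0 : 0 < γ := by positivity
  refine ⟨c₃ * γ / 2, γ + 1, c₁, C₁, by positivity, by positivity, hc₁, hC₁,
    fun τ hτ ε hε hεε₀ => ?_⟩
  obtain ⟨k₁, hk₁⟩ := hmax τ hτ ε hε hεε₀
  have hτ0 : (0 : ℝ) < τ := by positivity
  have hL := Real.tendsto_log_atTop
  -- The three conditions on `log k` serve, in order, to absorb the additive terms of the upper
  -- bound into one extra `log k / τ`, to lose at most half of the main term in the lower bound, and
  -- to ensure `δ ≤ 1`.
  obtain ⟨k₂, hk₂⟩ := eventually_atTop.1 ((eventually_ge_atTop k₁).and ((eventually_ge_atTop 1).and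
    ((hL.eventually_ge_atTop (τ * (τ * fadingMean m + Real.log 2 - γ * Real.log c₁
      - γ * Real.log ε / τ + C₂))).and ((hL.eventually_ge_atTop
      (2 * τ / γ * (γ * Real.log C₁ - Real.log K))).and
      (hL.eventually_ge_atTop (τ * Real.log C₁ + Real.log ε))))))
  refine ⟨k₂, fun s lamR hs hR hk => ?_⟩
  set k := meanReceivers d s lamR with hkdef
  obtain ⟨hkk₁, hk1, hA, hB, hD⟩ := hk₂ k hk
  obtain ⟨hgreatest, hδlow, hδup⟩ := hk₁ s lamR hs hR hkk₁
  refine ⟨hk1, hgreatest, ?_⟩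
  set lam := maxIntensity d α m β τ s lamR ε with hlamdef
  set δ := lam * s ^ d with hδ
  set x := (ε / k) ^ (1 / (τ : ℝ)) with hx
  have hk0 : 0 < k := by linarith
  have hx0 : 0 < x := by positivity
  have hδ0 : 0 < δ := lt_of_lt_of_le (by positivity) hδlow
  have hs0 : 0 < s := by linarith
  have hlam : 0 < lam := pos_of_mul_pos_left hδ0 (by positivity)
  have hlogx : Real.log x = (Real.log ε - Real.log k) / τ := by
    rw [hx, Real.log_rpow (by positivity), Real.log_div hε.ne' hk0.ne']; ring
  have hlogδ1 : Real.log c₁ + Real.log x ≤ Real.log δ := by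
    rw [← Real.log_mul hc₁.ne' hx0.ne']; exact Real.log_le_log (by positivity) hδlow
  have hlogδ2 : Real.log δ ≤ Real.log C₁ + Real.log x := by
    rw [← Real.log_mul hC₁.ne' hx0.ne']; exact Real.log_le_log hδ0 hδup
  have hδ1 : δ ≤ 1 := by
    rw [← Real.log_nonpos_iff hδ0.le]
    have : Real.log C₁ + (Real.log ε - Real.log k) / τ ≤ 0 := by
      have h1 : Real.log C₁ ≤ (Real.log k - Real.log ε) / τ := by
        rw [le_div_iff₀ hτ0]; linarith
      have h2 : (Real.log ε - Real.log k) / τ = -((Real.log k - Real.log ε) / τ) := by ring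
      linarith
    linarith
  obtain ⟨hint, hrate⟩ := hup τ s lam hs hlam hδ1
  have hrate' := hlow τ s lam hτ hs hlam hδ1
  have hlogrpow : Real.log (δ ^ (-γ)) = -γ * Real.log δ := Real.log_rpow hδ0 _
  have hpow0 : 0 < δ ^ (-γ) := by positivity
  refine ⟨hint, ⟨?_, ?_⟩, hδlow, hδup⟩
  · refine le_trans ?_ hrate'
    have h1 : Real.log K + -γ * Real.log δ ≤ Real.log (1 + K * δ ^ (-γ)) := by
      rw [← hlogrpow, ← Real.log_mul hK.ne' hpow0.ne']
      exact Real.log_le_log (by positivity) (by linarith)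
    have h2 : γ * Real.log C₁ - Real.log K ≤ γ / 2 * (Real.log k / τ) := by
      rw [div_mul_eq_mul_div, div_le_iff₀ hγ0] at hB
      rw [div_mul_div_comm, le_div_iff₀ (by positivity)]
      linarith
    have h3 : γ * Real.log δ ≤ γ * (Real.log C₁ + (Real.log ε - Real.log k) / τ) := by
      rw [← hlogx]; gcongr
    have h4 : Real.log ε / τ ≤ 0 :=
      div_nonpos_of_nonpos_of_nonneg (Real.log_nonpos hε.le (by linarith)) hτ0.le
    have h5 : γ * (Real.log C₁ + (Real.log ε - Real.log k) / τ)
        = γ * Real.log C₁ + γ * (Real.log ε / τ) - γ * (Real.log k / τ) := by ring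
    have h6 : γ * (Real.log ε / τ) ≤ 0 := mul_nonpos_of_nonneg_of_nonpos hγ0.le h4
    calc c₃ * γ / 2 * (Real.log k / τ) = c₃ * (γ / 2 * (Real.log k / τ)) := by ring
      _ ≤ c₃ * Real.log (1 + K * δ ^ (-γ)) := by gcongr; linarith
  · refine hrate.trans ?_
    have h1 : Real.log (1 + δ ^ (-γ)) ≤ Real.log 2 + -γ * Real.log δ := by
      rw [← hlogrpow, ← Real.log_mul (by norm_num) hpow0.ne']
      refine Real.log_le_log (by positivity) ?_
      have := Real.one_le_rpow_of_pos_of_le_one_of_nonpos hδ0 hδ1 (neg_nonpos.2 hγ0.le)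
      linarith
    have h3 : γ * (Real.log c₁ + (Real.log ε - Real.log k) / τ) ≤ γ * Real.log δ := by
      rw [← hlogx]; gcongr
    have h5 : γ * (Real.log c₁ + (Real.log ε - Real.log k) / τ)
        = γ * Real.log c₁ + γ * Real.log ε / τ - γ * (Real.log k / τ) := by ring
    rw [mul_comm, ← le_div_iff₀ hτ0] at hA
    linarith

/-- Multiplying by `s^d` turns the intensity into the load and gives one estimate for all regimes.
The factor `(τ+1)^{1/τ}` in `rho` lies in `[1, 2]` because `τ + 1 ≤ 2^τ`. -/
theorem capacity_bounds {d : ℕ} {α : ℝ} (hd : 1 ≤ d) (hα : (d : ℝ) < α) {m : ℕ} (hm : 1 ≤ m)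
    {β : ℝ} (hβ : 0 < β) {ε₀ : ℝ} (hε₀ : ε₀ < 1) :
    ∃ c C : ℝ, 0 < c ∧ 0 < C ∧ ∀ τ : ℕ, 1 ≤ τ → ∀ ε : ℝ, 0 < ε → ε ≤ ε₀ →
      ∃ k₀ : ℝ, ∀ s lamR : ℝ, 1 ≤ s → 0 < lamR → k₀ ≤ meanReceivers d s lamR →
        0 ≤ rho τ ε * meanReceivers d s lamR ^ (-(1 / (τ : ℝ))) *
          Real.log (meanReceivers d s lamR) ∧
        Between c C (rho τ ε * meanReceivers d s lamR ^ (-(1 / (τ : ℝ))) *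
          Real.log (meanReceivers d s lamR)) (capacity d α m β τ s lamR ε * s ^ d) := by
  obtain ⟨c, C, c', C', hc, hC, hc', hC', h⟩ := network_bounds hd hα hm hβ hε₀
  have hε₀1 : 0 < 1 - ε₀ := by linarith
  refine ⟨c * c' * (1 - ε₀) / 2, C * C', by positivity, by positivity, fun τ hτ ε hε hεε₀ => ?_⟩
  obtain ⟨k₀, hk₀⟩ := h τ hτ ε hε hεε₀
  refine ⟨k₀, fun s lamR hs hR hk => ?_⟩
  obtain ⟨hk1, -, -, ⟨hb1, hb2⟩, hδ1, hδ2⟩ := hk₀ s lamR hs hR hk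
  have hτ0 : (0 : ℝ) < τ := by positivity
  set k := meanReceivers d s lamR
  have hk0 : 0 < k := by linarith
  have hlog : 0 ≤ Real.log k := Real.log_nonneg hk1
  set lam := maxIntensity d α m β τ s lamR ε with hlamdef
  set b := multicastRate d α m τ s lam with hb
  set x := (ε / k) ^ (1 / (τ : ℝ)) with hx
  set w := ((τ : ℝ) + 1) ^ (1 / (τ : ℝ)) with hw
  set y := Real.log k / τ with hy
  have hx0 : 0 < x := by positivity
  have hy0 : 0 ≤ y := by positivity
  have hw1 : 1 ≤ w := Real.one_le_rpow (by linarith) (by positivity)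
  have hw2 : w ≤ 2 := by
    have h1 : ((τ : ℝ) + 1) ≤ 2 ^ (τ : ℝ) := by
      rw [Real.rpow_natCast]
      exact_mod_cast Nat.lt_two_pow_self
    calc w ≤ (2 ^ (τ : ℝ)) ^ (1 / (τ : ℝ)) := by rw [hw]; gcongr
      _ = 2 := by rw [← Real.rpow_mul (by norm_num), mul_one_div_cancel hτ0.ne', Real.rpow_one]
  have hR : rho τ ε * k ^ (-(1 / (τ : ℝ))) * Real.log k = 1 / τ * (w * (y * x)) := by
    rw [rho, Real.mul_rpow hε.le (by positivity), ← hw, hx, Real.div_rpow hε.le hk0.le,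
      Real.rpow_neg hk0.le, hy]
    field_simp
  have hcap : capacity d α m β τ s lamR ε * s ^ d = 1 / τ * (b * (lam * s ^ d) * (1 - ε)) := by
    rw [capacity]; ring
  rw [hR, hcap]
  have hb0 : 0 ≤ b := le_trans (by positivity) hb1
  have hδ0 : 0 ≤ lam * s ^ d := le_trans (by positivity) hδ1
  refine ⟨by positivity, ?_, ?_⟩
  · calc c * c' * (1 - ε₀) / 2 * (1 / τ * (w * (y * x)))
        = 1 / τ * ((c * y) * (c' * x) * (1 - ε₀) * (w / 2)) := by ring
      _ ≤ 1 / τ * ((c * y) * (c' * x) * (1 - ε₀) * 1) := by gcongr; linarith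
      _ ≤ 1 / τ * (b * (lam * s ^ d) * (1 - ε)) := by
        rw [mul_one]; gcongr
  · calc 1 / τ * (b * (lam * s ^ d) * (1 - ε))
        ≤ 1 / τ * ((C * y) * (C' * x) * 1) := by gcongr <;> linarith
      _ = C * C' * (1 / τ * (1 * (y * x))) := by ring
      _ ≤ C * C' * (1 / τ * (w * (y * x))) := by gcongr

/-- Used with `v = s^d` and `κ` equal to `1`, `k^{-1}` or `k^{-1/2}` according to the regime. -/
lemma between_of_mul {c C p P R κ g v : ℝ} (hc : 0 < c) (hC : 0 < C) (hR : 0 ≤ R)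
    (hv : 0 < v) (h : Between c C R (g * v)) (hp : p * κ ≤ v⁻¹) (hP : v⁻¹ ≤ P * κ) :
    Between (c * p) (C * P) (R * κ) g := by
  have hg : g = g * v * v⁻¹ := by field_simp
  rw [hg]
  constructor
  · calc c * p * (R * κ) = c * R * (p * κ) := by ring
      _ ≤ c * R * v⁻¹ := by gcongr
      _ ≤ _ := mul_le_mul_of_nonneg_right h.1 (by positivity)
  · calc g * v * v⁻¹ ≤ C * R * v⁻¹ := mul_le_mul_of_nonneg_right h.2 (by positivity)
      _ ≤ C * R * (P * κ) := by gcongr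
      _ = _ := by ring

end Multicast

end

/-! ### The three network regimes -/

theorem mainTheorem2 (d : ℕ) (hd : 1 ≤ d) (α : ℝ) (hα : (d : ℝ) < α) (m : ℕ) (hm : 1 ≤ m)
    (β : ℝ) (hβ : 0 < β) (ε₀ : ℝ) (hε₀ : 0 < ε₀) (hε₀' : ε₀ < 1) :
    -- in every network: the maximum intensity is attained, and the rate there is of order log(k)/τ
    (∃ c C : ℝ, 0 < c ∧ 0 < C ∧ ∀ τ : ℕ, 1 ≤ τ → ∀ ε : ℝ, 0 < ε → ε ≤ ε₀ →
      ∃ k₀ : ℝ, ∀ s lamR : ℝ, 1 ≤ s → 0 < lamR → k₀ ≤ Multicast.meanReceivers d s lamR →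
        IsGreatest (Multicast.feasible d α m β τ s lamR ε)
          (Multicast.maxIntensity d α m β τ s lamR ε) ∧
        MeasureTheory.Integrable (Multicast.edgeRate α s)
          (Multicast.edgeLaw d α m τ (Multicast.maxIntensity d α m β τ s lamR ε)) ∧
        Multicast.Between c C (Real.log (Multicast.meanReceivers d s lamR) / τ)
          (Multicast.multicastRate d α m τ s (Multicast.maxIntensity d α m β τ s lamR ε))) ∧
    -- dense networks: fixed cluster radius
    (∀ s : ℝ, 1 ≤ s →
      ∃ c C : ℝ, 0 < c ∧ 0 < C ∧ ∀ τ : ℕ, 1 ≤ τ → ∀ ε : ℝ, 0 < ε → ε ≤ ε₀ →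
        ∃ k₀ : ℝ, ∀ lamR : ℝ, 0 < lamR → k₀ ≤ Multicast.meanReceivers d s lamR →
          Multicast.Between c C
            (Multicast.rho τ ε * Multicast.meanReceivers d s lamR ^ (-(1 / (τ : ℝ))) *
              Real.log (Multicast.meanReceivers d s lamR))
            (Multicast.capacity d α m β τ s lamR ε)) ∧
    -- large networks: fixed receiver intensity
    (∀ lamR : ℝ, 0 < lamR →
      ∃ c C : ℝ, 0 < c ∧ 0 < C ∧ ∀ τ : ℕ, 1 ≤ τ → ∀ ε : ℝ, 0 < ε → ε ≤ ε₀ →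
        ∃ k₀ : ℝ, ∀ s : ℝ, 1 ≤ s → k₀ ≤ Multicast.meanReceivers d s lamR →
          Multicast.Between c C
            (Multicast.rho τ ε * Multicast.meanReceivers d s lamR ^ (-(1 + 1 / (τ : ℝ))) *
              Real.log (Multicast.meanReceivers d s lamR))
            (Multicast.capacity d α m β τ s lamR ε)) ∧
    -- large dense networks: receiver intensity of the order of the cluster volume
    (∀ a A : ℝ, 0 < a → a ≤ A →
      ∃ c C : ℝ, 0 < c ∧ 0 < C ∧ ∀ τ : ℕ, 1 ≤ τ → ∀ ε : ℝ, 0 < ε → ε ≤ ε₀ →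
        ∃ k₀ : ℝ, ∀ s lamR : ℝ, 1 ≤ s →
          a * Multicast.clusterVolume d s ≤ lamR → lamR ≤ A * Multicast.clusterVolume d s →
          k₀ ≤ Multicast.meanReceivers d s lamR →
          Multicast.Between c C
            (Multicast.rho τ ε *
              Multicast.meanReceivers d s lamR ^ (-(((τ : ℝ) + 2) / (2 * (τ : ℝ)))) *
              Real.log (Multicast.meanReceivers d s lamR))
            (Multicast.capacity d α m β τ s lamR ε)) := by
  obtain ⟨c, C, hc, hC, hcap⟩ := Multicast.capacity_bounds hd hα hm hβ hε₀'
  have hV := Multicast.unitVolume_pos d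
  refine ⟨?_, fun s hs => ?_, fun lamR hR => ?_, fun a A ha haA => ?_⟩
  · obtain ⟨c, C, _, _, hc, hC, _, _, h⟩ := Multicast.network_bounds hd hα hm hβ hε₀'
    refine ⟨c, C, hc, hC, fun τ hτ ε hε hεε₀ => ?_⟩
    obtain ⟨k₀, hk₀⟩ := h τ hτ ε hε hεε₀
    refine ⟨k₀, fun s lamR hs hR hk => ?_⟩
    obtain ⟨-, h1, h2, h3, -⟩ := hk₀ s lamR hs hR hk
    exact ⟨h1, h2, h3⟩
  · have hsd : 0 < s ^ d := by positivity
    refine ⟨c * (s ^ d)⁻¹, C * (s ^ d)⁻¹, by positivity, by positivity, fun τ hτ ε hε hεε₀ => ?_⟩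
    obtain ⟨k₀, hk₀⟩ := hcap τ hτ ε hε hεε₀
    refine ⟨k₀, fun lamR hR hk => ?_⟩
    obtain ⟨h0, h1⟩ := hk₀ s lamR hs hR hk
    have h2 := Multicast.between_of_mul (p := (s ^ d)⁻¹) (P := (s ^ d)⁻¹) (κ := 1) hc hC h0 hsd h1
      (by simp) (by simp)
    rwa [mul_one] at h2
  · refine ⟨c * (Multicast.unitVolume d * lamR), C * (Multicast.unitVolume d * lamR),
      by positivity, by positivity, fun τ hτ ε hε hεε₀ => ?_⟩
    obtain ⟨k₀, hk₀⟩ := hcap τ hτ ε hε hεε₀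
    refine ⟨k₀, fun s hs hk => ?_⟩
    obtain ⟨h0, h1⟩ := hk₀ s lamR hs hR hk
    have hk0 : 0 < Multicast.meanReceivers d s lamR :=
      Multicast.meanReceivers_pos (by linarith) hR
    have hsd : 0 < s ^ d := by positivity
    have hinv : Multicast.unitVolume d * lamR * (Multicast.meanReceivers d s lamR)⁻¹
        = (s ^ d)⁻¹ := by
      rw [Multicast.meanReceivers, Multicast.clusterVolume_eq (by linarith)]; field_simp
    have h2 := Multicast.between_of_mul hc hC h0 hsd h1 hinv.le hinv.ge
    convert h2 using 1
    rw [neg_add', Real.rpow_sub hk0, Real.rpow_neg_one, Real.rpow_neg hk0.le]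
    ring
  · have hA : 0 < A := ha.trans_le haA
    refine ⟨c * (Multicast.unitVolume d * √a), C * (Multicast.unitVolume d * √A),
      by positivity, by positivity, fun τ hτ ε hε hεε₀ => ?_⟩
    obtain ⟨k₀, hk₀⟩ := hcap τ hτ ε hε hεε₀
    refine ⟨k₀, fun s lamR hs haR hAR hk => ?_⟩
    have hs0 : 0 < s := by linarith
    have hsd : 0 < s ^ d := by positivity
    have hμ := Multicast.clusterVolume_eq (d := d) hs0.le
    set μ := Multicast.clusterVolume d s with hμdef
    have hμ0 : 0 < μ := by rw [hμ]; positivity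
    have hR : 0 < lamR := lt_of_lt_of_le (by positivity) haR
    obtain ⟨h0, h1⟩ := hk₀ s lamR hs hR hk
    have hk0 : 0 < Multicast.meanReceivers d s lamR := Multicast.meanReceivers_pos hs0 hR
    have hkμ : Multicast.meanReceivers d s lamR = μ * lamR := rfl
    set k := Multicast.meanReceivers d s lamR with hkdef
    have hinv : (s ^ d)⁻¹ = Multicast.unitVolume d * μ⁻¹ := by rw [hμ]; field_simp
    -- Since `k = μ λ_r` with `λ_r` between `a μ` and `A μ`, the cluster volume is of order `√k`;
    -- this is the source of the extra exponent `-1/2`.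
    have hka : √a * μ ≤ √k := by
      refine Real.le_sqrt_of_sq_le ?_
      rw [mul_pow, Real.sq_sqrt ha.le, hkμ]; nlinarith
    have hkA : √k ≤ √A * μ := by
      refine Real.sqrt_le_iff.2 ⟨by positivity, ?_⟩
      rw [mul_pow, Real.sq_sqrt hA.le, hkμ]; nlinarith
    have hsk : 0 < √k := by positivity
    have h2 := Multicast.between_of_mul (p := Multicast.unitVolume d * √a)
      (P := Multicast.unitVolume d * √A) (κ := (√k)⁻¹) hc hC h0 hsd h1
      (by
        rw [hinv, mul_assoc]
        gcongr
        rw [← div_eq_mul_inv, div_le_iff₀ hsk, inv_mul_eq_div, le_div_iff₀ hμ0]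
        exact hka)
      (by
        rw [hinv, mul_assoc]
        gcongr
        rw [← div_eq_mul_inv, le_div_iff₀ hsk, inv_mul_eq_div, div_le_iff₀ hμ0]
        exact hkA)
    convert h2 using 1
    have hexp : -(((τ : ℝ) + 2) / (2 * (τ : ℝ))) = -(1 / (τ : ℝ)) + -(1 / 2) := by
      field_simp; ring
    rw [hexp, Real.rpow_add hk0, Real.rpow_neg hk0.le (1 / 2), Real.sqrt_eq_rpow]
    ring
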